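/- Consider a periodic chain of $L\ge 1$ sites, each with Hilbert space $\mathbb C^d$ ($d\ge 1$), and let $\hat T$ be the lattice translation by one site. Let $\hat q$ be a Hermitian operator on $\mathbb C^d$ all of whose eigenvalues are integers, let $\hat q_x$ be its copy on site $x$ (so $\hat T\hat q_x\hat T^\dagger=\hat q_{x+1}$), let $\hat Q=\sum_{x=0}^{L-1}\hat q_x$, and let $\|\hat q\|$ be the operator norm of $\hat q$. A geometrically local circuit of depth $t$ is a product of $t$ layers, each of which is a product of unitary gates acting on pairwise disjoint pairs of neighbouring sites (with periodic boundary conditions). For $\delta\in\mathbb R$ let $\mathscr C^\delta(|\psi\rangle)$ be the smallest $t$ such that some geometrically local circuit $V$ of depth $t$ satisfies $\big\||\psi\rangle\langle\psi|-V|0^L\rangle\langle 0^L|V^\dagger\big\|_1\le\delta$, where $\|\cdot\|_1$ is the trace norm. **Theorem ($U(1)\times T$ LSM).** Let $|\psi\rangle$ be a unit vector that is translation invariant, $\hat T|\psi\rangle\propto|\psi\rangle$, and $U(1)$ symmetric with non-commensurate filling, $$\exp\!\Big(\frac{2\pi i\hat Q}{L}\Big)|\psi\rangle=e^{i\alpha}|\psi\rangle,\qquad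 e^{i\alpha}\ne 1 ,$$ with $\alpha\in\mathbb R$. If $\mathscr C^\delta(|\psi\rangle)=t$ with $t\ge 1$, then either $$\delta>\Big(1-e\,\delta-e\Big(\frac{9\pi t^2\|\hat q\|}{2L}\Big)^2\Big)^{L/t},$$ or $$t\ \ge\ L^{1/2}\sqrt{\frac{2}{9\pi\|\hat q\|}\Big(\frac{1}{7e}-\delta\Big)}\,,$$ where $e=\exp(1)$. Nothing is claimed for $\delta>\frac1{7e}$: the square root is then read as $0$, so that the second alternative holds. (If the second alternative fails, the base of the power in the first one is positive.) -/

import Mathlib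

open scoped Matrix

noncomputable section

namespace SpinChain

/-- Basis configurations of a periodic chain of `L` sites, each carrying a `d`-level system. -/
abbrev Config (L d : ℕ) : Type := ZMod L → Fin d

/-- The Hilbert space `(ℂ^d)^{⊗ L}` of the chain, in the configuration basis. -/
abbrev Hilb (L d : ℕ) : Type := EuclideanSpace ℂ (Config L d)

/-- Operators on the chain, as matrices in the configuration basis. -/
abbrev Op (L d : ℕ) : Type := Matrix (Config L d) (Config L d) ℂ

variable {L d : ℕ} [NeZero L]

/-- The action of an operator on a vector of the chain. -/
def apply (A : Op L d) (ψ : Hilb L d) : Hilb L d := Matrix.toEuclideanLin A ψ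

/-- The lattice translation `T`: it moves the content of site `x` to site `x + 1`,
with periodic boundary conditions. -/
def translation (L d : ℕ) [NeZero L] : Op L d :=
  Matrix.of fun f g => if ∀ x, f (x + 1) = g x then 1 else 0

/-- The operator `A` acting on the sites in `S`, tensored with the identity elsewhere. -/
def embed (S : Finset (ZMod L)) (A : Matrix (S → Fin d) (S → Fin d) ℂ) : Op L d :=
  Matrix.of fun f g =>
    if ∀ x, x ∉ S → f x = g x then A (fun x => f x) (fun x => g x) else 0

/-- The one-site operator `q` placed on the site `x`. -/
def siteOp (q : Matrix (Fin d) (Fin d) ℂ) (x : ZMod L) : Op L d :=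
  Matrix.of fun f g => if ∀ y, y ≠ x → f y = g y then q (f x) (g x) else 0

/-- The total charge `Q = ∑ₓ qₓ`. -/
def totalCharge (L : ℕ) [NeZero L] (q : Matrix (Fin d) (Fin d) ℂ) : Op L d :=
  ∑ x : ZMod L, siteOp q x

/-- The operator norm of a one-site operator. -/
def opNorm (q : Matrix (Fin d) (Fin d) ℂ) : ℝ := ‖Matrix.toEuclideanCLM (𝕜 := ℂ) q‖

/-- The two neighbouring sites `x` and `x + 1`. -/
def bond (x : ZMod L) : Finset (ZMod L) := {x, x + 1}

/-- One layer of a geometrically local circuit: a product of unitary gates that act on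
pairwise disjoint pairs of neighbouring sites. -/
def IsLayer (V : Op L d) : Prop :=
  ∃ gates : List ((x : ZMod L) × Matrix.unitaryGroup (bond x → Fin d) ℂ),
    gates.Pairwise (fun g h => Disjoint (bond g.1) (bond h.1)) ∧
    V = (gates.map fun g => embed (bond g.1) (g.2 : Matrix _ _ ℂ)).prod

/-- `V` is a geometrically local circuit with `t` layers. Layers may be empty, so these are
exactly the circuits of depth at most `t`. -/
def IsCircuit (t : ℕ) (V : Op L d) : Prop :=
  ∃ layers : List (Op L d), layers.length = t ∧ (∀ W ∈ layers, IsLayer W) ∧ V = layers.prod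

/-- The product state `|0^L⟩`. -/
def zeroState (L d : ℕ) [NeZero L] [NeZero d] : Hilb L d :=
  EuclideanSpace.single (fun _ => (0 : Fin d)) 1

/-- The rank-one operator `|ψ⟩⟨ψ|`. -/
def ketbra (ψ : Hilb L d) : Op L d := Matrix.vecMulVec ψ.ofLp (star ψ.ofLp)

/-- The trace norm: the sum of the singular values, which are the square roots of the
eigenvalues of `Aᴴ A`. -/
def traceNorm (A : Op L d) : ℝ :=
  ∑ i, √((Matrix.isHermitian_conjTranspose_mul_self A).eigenvalues i)

/-- The `δ`-approximate geometrically local complexity: the smallest depth of a geometrically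
local circuit that prepares, from `|0^L⟩`, a state within trace norm `δ` of `ψ`
(and `⊤` if there is no such circuit). -/
def approxComplexity [NeZero d] (δ : ℝ) (ψ : Hilb L d) : ℕ∞ :=
  ⨅ (t : ℕ) (_ : ∃ V : Op L d, IsCircuit t V ∧
    traceNorm (ketbra ψ - ketbra (apply V (zeroState L d))) ≤ δ), (t : ℕ∞)

end SpinChain

end

/-!
Let `φ = V|0^L⟩` be the circuit state close to `ψ`, and let `U = ⨂ₓ v ^ x` with
`v = exp (2πi q / L)` be the twist operator (`twist`). Since `q` has integer eigenvalues,
`v ^ L = 1`, so translating `U` multiplies it by a power of `exp (2πi Q / L)`. At non-commensurate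
filling this makes `U ψ` orthogonal to `ψ` (`inner_twist_eq_zero`), hence the overlap of `φ` with
`U φ` is at most `2δ` (`norm_inner_apply_le`).

On the other hand `U φ` looks like `φ` locally. Cut the chain into blocks of `t` sites and measure
`Vᴴ U φ` in the configuration basis. The event that a block is not in the state `0` is a projector
which, conjugated by `V`, lives on `3t` sites and annihilates `φ`. Because `ψ` is an eigenvector of
`exp (2πi Q / L)`, the twist may be recentred at the block, where it differs from the identity by
`O(t² ‖q‖ / L)`; so the event has probability at most `(10/9 y + 2δ)²` with `y = 9π t² ‖q‖ / (2L)`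
(`norm_local_apply_twist_le`, `sum_norm_twist_le`).

Finally `Vᴴ U V` is itself a shallow circuit applied to a product state, with light cones of radius
`2t`, so these events are exactly independent for blocks that are far apart
(`weight_excited_inter`), and each has at most `11` neighbours on the cycle of blocks
(`card_blockNeighbours_le`). The Lovász local lemma (`lovasz_local_lemma`) then bounds from below
the probability `|⟨φ, U φ⟩|²` that no block is excited by `(1 - x) ^ (⌊L / t⌋ + 1)` with
`x = 2y² + δ/2`. If the second alternative fails, then `y + δ < 1/19`, and comparing this with the
upper bound `4δ²` gives the first alternative.

Locality of operators is handled through the commutant (`LocalOn`): an operator is local to `S` if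
it commutes with all one-site operators outside `S`. Light cones of circuits are then obtained from
the fact that disjointly supported operators commute (`LocalOn.commute`).
-/

noncomputable section

namespace SpinChain

section Operators

variable {L d : ℕ} [NeZero L]

/-! ### Operators acting on vectors -/

lemma apply_mul (A B : Op L d) (ψ : Hilb L d) : apply (A * B) ψ = apply A (apply B ψ) := by
  ext f
  simp [apply, Matrix.mulVec_mulVec]

lemma apply_one (ψ : Hilb L d) : apply 1 ψ = ψ := by
  ext f
  simp [apply]

lemma apply_sub (A B : Op L d) (ψ : Hilb L d) : apply (A - B) ψ = apply A ψ - apply B ψ := by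
  simp [apply]

lemma apply_vec_sub (A : Op L d) (ψ φ : Hilb L d) :
    apply A (ψ - φ) = apply A ψ - apply A φ := by
  simp [apply]

lemma apply_smul (A : Op L d) (c : ℂ) (ψ : Hilb L d) : apply A (c • ψ) = c • apply A ψ := by
  simp [apply]

lemma inner_apply_right (A : Op L d) (ψ φ : Hilb L d) :
    inner ℂ ψ (apply A φ) = inner ℂ (apply Aᴴ ψ) φ := by
  unfold apply
  rw [Matrix.toEuclideanLin_conjTranspose_eq_adjoint, LinearMap.adjoint_inner_left]

lemma inner_apply_apply {V : Op L d} (hV : Vᴴ * V = 1) (ψ φ : Hilb L d) :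
    inner ℂ (apply V ψ) (apply V φ) = inner ℂ ψ φ := by
  rw [inner_apply_right, ← apply_mul, hV, apply_one]

lemma norm_apply_of_isometry {V : Op L d} (hV : Vᴴ * V = 1) (ψ : Hilb L d) :
    ‖apply V ψ‖ = ‖ψ‖ := by
  rw [@norm_eq_sqrt_re_inner ℂ, @norm_eq_sqrt_re_inner ℂ, inner_apply_apply hV]

lemma apply_zeroState [NeZero d] (A : Op L d) (f : Config L d) :
    apply A (zeroState L d) f = A f (fun _ => 0) := by
  simp [apply, zeroState, Matrix.toLpLin_apply]

lemma norm_zeroState [NeZero d] : ‖zeroState L d‖ = 1 := by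
  simp [zeroState]

/-! ### Product operators -/

/-- The product operator `⨂ₓ w x`, acting by the one-site operator `w x` on each site `x`. -/
def prodOp (w : ZMod L → Matrix (Fin d) (Fin d) ℂ) : Op L d :=
  Matrix.of fun f g => ∏ x, w x (f x) (g x)

lemma prodOp_mul (w w' : ZMod L → Matrix (Fin d) (Fin d) ℂ) :
    prodOp w * prodOp w' = prodOp (fun x => w x * w' x) := by
  ext f g
  simp only [prodOp, Matrix.mul_apply, Matrix.of_apply]
  rw [Fintype.prod_sum]
  simp [Finset.prod_mul_distrib]

lemma prodOp_one : prodOp (fun _ => 1 : ZMod L → Matrix (Fin d) (Fin d) ℂ) = 1 := by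
  ext f g
  simp only [prodOp, Matrix.of_apply, Matrix.one_apply, Finset.prod_ite_zero, funext_iff]
  simp

lemma prodOp_conjTranspose (w : ZMod L → Matrix (Fin d) (Fin d) ℂ) :
    (prodOp w)ᴴ = prodOp (fun x => (w x)ᴴ) := by
  ext f g
  simp [prodOp, Matrix.conjTranspose_apply]

lemma prodOp_isometry {w : ZMod L → Matrix (Fin d) (Fin d) ℂ} (hw : ∀ x, (w x)ᴴ * w x = 1) :
    (prodOp w)ᴴ * prodOp w = 1 := by
  rw [prodOp_conjTranspose, prodOp_mul]
  simp [hw, prodOp_one]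

lemma siteOp_eq_prodOp (B : Matrix (Fin d) (Fin d) ℂ) (x : ZMod L) :
    siteOp B x = prodOp (Function.update (fun _ => 1) x B) := by
  ext f g
  simp only [siteOp, prodOp, Matrix.of_apply]
  rw [← Finset.mul_prod_erase Finset.univ _ (Finset.mem_univ x)]
  have : ∏ y ∈ Finset.univ.erase x, Function.update (fun _ => (1 : Matrix (Fin d) (Fin d) ℂ)) x B y
      (f y) (g y) = ∏ y ∈ Finset.univ.erase x, if f y = g y then 1 else 0 := by
    refine Finset.prod_congr rfl fun y hy => ?_
    rw [Function.update_of_ne (Finset.ne_of_mem_erase hy), Matrix.one_apply]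
  rw [this, Finset.prod_ite_zero]
  simp

lemma siteOp_mul (A B : Matrix (Fin d) (Fin d) ℂ) (x : ZMod L) :
    siteOp (A * B) x = siteOp A x * siteOp B x := by
  simp only [siteOp_eq_prodOp, prodOp_mul]
  congr 1
  ext1 y
  by_cases h : y = x
  · subst h; simp
  · simp [Function.update_of_ne h]

lemma siteOp_one (x : ZMod L) : siteOp (1 : Matrix (Fin d) (Fin d) ℂ) x = 1 := by
  rw [siteOp_eq_prodOp, Function.update_eq_self_iff.2 rfl, prodOp_one]

/-- Placing an operator on the site `x` is a homomorphism of star algebras. -/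
def siteHom (L d : ℕ) [NeZero L] (x : ZMod L) : Matrix (Fin d) (Fin d) ℂ →⋆ₐ[ℂ] Op L d where
  toFun B := siteOp B x
  map_one' := siteOp_one x
  map_mul' A B := siteOp_mul A B x
  map_zero' := by ext f g; simp [siteOp]
  map_add' A B := by
    ext f g
    simp only [siteOp, Matrix.of_apply, Matrix.add_apply]
    split_ifs <;> simp
  commutes' r := by
    rw [Algebra.algebraMap_eq_smul_one, Algebra.algebraMap_eq_smul_one, ← siteOp_one x]
    ext f g
    simp only [siteOp, Matrix.of_apply, Matrix.smul_apply]
    split_ifs <;> simp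
  map_star' B := by
    simp only [Matrix.star_eq_conjTranspose, siteOp_eq_prodOp, prodOp_conjTranspose]
    congr 1
    ext1 y
    by_cases h : y = x
    · subst h; simp
    · simp [Function.update_of_ne h]

@[simp] lemma siteHom_apply (x : ZMod L) (B : Matrix (Fin d) (Fin d) ℂ) :
    siteHom L d x B = siteOp B x := rfl

lemma continuous_siteHom (x : ZMod L) : Continuous (siteHom L d x) := by
  refine continuous_matrix fun f g => ?_
  simp only [siteHom_apply, siteOp, Matrix.of_apply]
  split_ifs
  · fun_prop
  · fun_prop

lemma sum_update_eq (x : ZMod L) (g : Config L d) (F : Config L d → ℂ) :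
    (∑ h, if ∀ y, y ≠ x → h y = g y then F h else 0) = ∑ a, F (Function.update g x a) := by
  rw [← Finset.sum_filter]
  refine (Finset.sum_nbij' (fun a => Function.update g x a) (fun h => h x) ?_ ?_ ?_ ?_ ?_).symm
  · intro a _
    simp +contextual [Function.update_of_ne]
  · simp
  · simp
  · intro h hh
    ext1 y
    by_cases hy : y = x
    · subst hy; simp
    · simp [Function.update_of_ne hy, (Finset.mem_filter.1 hh).2 y hy]
  · simp

lemma mul_siteOp_apply (M : Op L d) (B : Matrix (Fin d) (Fin d) ℂ) (x : ZMod L)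
    (f g : Config L d) :
    (M * siteOp B x) f g = ∑ a, M f (Function.update g x a) * B a (g x) := by
  rw [Matrix.mul_apply]
  have := sum_update_eq x g (fun h => M f h * B (h x) (g x))
  simp only [Function.update_self] at this
  rw [← this]
  refine Finset.sum_congr rfl fun h _ => ?_
  simp only [siteOp, Matrix.of_apply]
  split_ifs <;> simp

lemma siteOp_mul_apply (M : Op L d) (B : Matrix (Fin d) (Fin d) ℂ) (x : ZMod L)
    (f g : Config L d) :
    (siteOp B x * M) f g = ∑ a, B (f x) a * M (Function.update f x a) g := by
  rw [Matrix.mul_apply]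
  have := sum_update_eq x f (fun h => B (f x) (h x) * M h g)
  simp only [Function.update_self] at this
  rw [← this]
  refine Finset.sum_congr rfl fun h _ => ?_
  simp only [siteOp, Matrix.of_apply, eq_comm (a := f _)]
  split_ifs <;> simp

/-! ### Local operators -/

/-- The operator `A` is supported on the set of sites `S`. This is encoded through the commutant:
`A` commutes with every one-site operator placed outside `S`. -/
def LocalOn (S : Set (ZMod L)) (A : Op L d) : Prop :=
  ∀ x ∉ S, ∀ B : Matrix (Fin d) (Fin d) ℂ, Commute A (siteOp B x)

namespace LocalOn

variable {S S' : Set (ZMod L)} {A B : Op L d}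

lemma mono (hA : LocalOn S A) (h : S ⊆ S') : LocalOn S' A := fun x hx => hA x fun hS => hx (h hS)

lemma mul (hA : LocalOn S A) (hB : LocalOn S B) : LocalOn S (A * B) :=
  fun x hx C => (hA x hx C).mul_left (hB x hx C)

lemma one_sub (hA : LocalOn S A) : LocalOn S (1 - A) :=
  fun x hx C => (Commute.one_left _).sub_left (hA x hx C)

lemma conjTranspose (hA : LocalOn S A) : LocalOn S Aᴴ := by
  intro x hx C
  have h := (hA x hx Cᴴ).star_star
  rwa [← siteHom_apply, ← Matrix.star_eq_conjTranspose, map_star, star_star, siteHom_apply] at h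

lemma commute_entry (hA : LocalOn S A) {x : ZMod L} (hx : x ∉ S) (f g : Config L d)
    (a b : Fin d) :
    (if g x = b then A f (Function.update g x a) else 0) =
      if f x = a then A (Function.update f x b) g else 0 := by
  have h := congrFun (congrFun (hA x hx (Matrix.single a b 1)).eq f) g
  rw [mul_siteOp_apply, siteOp_mul_apply] at h
  simp only [Matrix.single_apply] at h
  rw [Finset.sum_eq_single a, Finset.sum_eq_single b] at h
  · simpa [eq_comm] using h
  all_goals simp +contextual [eq_comm]

lemma eq_of_ne_zero (hA : LocalOn S A) {f g : Config L d} (h : A f g ≠ 0) {x : ZMod L}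
    (hx : x ∉ S) : f x = g x := by
  have := hA.commute_entry hx f g (g x) (g x)
  by_contra hne
  simp [hne] at this
  exact h this

lemma entry_update (hA : LocalOn S A) {f g : Config L d} {x : ZMod L} (hx : x ∉ S)
    (hfg : f x = g x) (c : Fin d) :
    A (Function.update f x c) (Function.update g x c) = A f g := by
  have := hA.commute_entry hx f (Function.update g x c) (f x) c
  simp [hfg] at this
  exact this.symm

lemma entry_piecewise (hA : LocalOn S A) {f g : Config L d} (c : Config L d)
    (R : Finset (ZMod L)) (hR : ∀ x ∈ R, x ∉ S ∧ f x = g x) :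
    A (R.piecewise c f) (R.piecewise c g) = A f g := by
  induction R using Finset.induction_on with
  | empty => simp
  | insert y R hy ih =>
    rw [Finset.piecewise_insert, Finset.piecewise_insert, hA.entry_update (hR y (by simp)).1,
      ih fun x hx => hR x (by simp [hx])]
    simp [hy, (hR y (by simp)).2]

/-- The entries of a local operator do not see the common values of the configurations outside
its support. -/
lemma entry_congr (hA : LocalOn S A) {f g f' g' : Config L d}
    (hS : ∀ x ∈ S, f x = f' x ∧ g x = g' x) (hc : ∀ x ∉ S, f x = g x ∧ f' x = g' x) :
    A f g = A f' g' := by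
  classical
  rw [← hA.entry_piecewise f' (Finset.univ.filter (· ∉ S)) 
    (by simpa using fun x hx => ⟨hx, (hc x hx).1⟩)]
  congr 1
  · ext1 x
    by_cases hx : x ∈ S <;> simp [Finset.piecewise, hx, hS]
  · ext1 x
    by_cases hx : x ∈ S <;> simp [Finset.piecewise, hx, hS, hc]

theorem commute (hA : LocalOn S A) (hB : LocalOn S' B) (h : Disjoint S S') : Commute A B := by
  classical
  have hS' : ∀ x ∈ S, x ∉ S' := fun x hx hx' => Set.disjoint_left.1 h hx hx'
  ext f g
  rw [Matrix.mul_apply, Matrix.mul_apply]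
  -- The only intermediate configurations that contribute take the values of `g` on one of the
  -- two supports and those of `f` on the other.
  rw [Finset.sum_eq_single (fun x => if x ∈ S then g x else f x),
    Finset.sum_eq_single (fun x => if x ∈ S then f x else g x)]
  · by_cases hfg : ∀ x, x ∉ S → x ∉ S' → f x = g x
    · rw [mul_comm]
      congr 1
      · refine hB.entry_congr (fun x hx => ?_) (fun x hx => ?_)
        · have : x ∉ S := fun h' => hS' x h' hx
          simp [this]
        · by_cases hxS : x ∈ S <;> simp [hxS]
          exact hfg x hxS hx
      · refine hA.entry_congr (fun x hx => by simp [hx]) (fun x hx => by simp [hx])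
    · push Not at hfg
      obtain ⟨x, hx, hx', hne⟩ := hfg
      have h1 : B (fun x => if x ∈ S then g x else f x) g = 0 := by
        by_contra h0
        have := hB.eq_of_ne_zero h0 hx'
        simp [hx] at this
        exact hne this
      have h2 : B f (fun x => if x ∈ S then f x else g x) = 0 := by
        by_contra h0
        have := hB.eq_of_ne_zero h0 hx'
        simp [hx] at this
        exact hne this
      rw [h1, h2]; simp
  · intro h _ hne
    by_contra h0
    refine hne (funext fun x => ?_)
    have hB0 := left_ne_zero_of_mul h0
    have hA0 := right_ne_zero_of_mul h0
    by_cases hx : x ∈ S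
    · simp [hx, hB.eq_of_ne_zero hB0 (hS' x hx)]
    · simp [hx, hA.eq_of_ne_zero hA0 hx]
  · simp
  · intro h _ hne
    by_contra h0
    refine hne (funext fun x => ?_)
    have hA0 := left_ne_zero_of_mul h0
    have hB0 := right_ne_zero_of_mul h0
    by_cases hx : x ∈ S
    · simp [hx, hB.eq_of_ne_zero hB0 (hS' x hx)]
    · simp [hx, hA.eq_of_ne_zero hA0 hx]
  · simp

/-- Product states have no correlations: disjointly supported operators have independent
expectation values in a configuration state. -/
theorem mul_apply_const (hA : LocalOn S A) (hB : LocalOn S' B) (h : Disjoint S S')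
    (f : Config L d) : (A * B) f f = A f f * B f f := by
  rw [Matrix.mul_apply, Finset.sum_eq_single f]
  · intro g _ hne
    by_contra h0
    refine hne (funext fun x => ?_)
    by_cases hx : x ∈ S
    · exact hB.eq_of_ne_zero (right_ne_zero_of_mul h0) (Set.disjoint_left.1 h hx)
    · exact (hA.eq_of_ne_zero (left_ne_zero_of_mul h0) hx).symm
  · simp

end LocalOn

lemma localOn_prodOp {S : Set (ZMod L)} {w : ZMod L → Matrix (Fin d) (Fin d) ℂ}
    (hw : ∀ x ∉ S, w x = 1) : LocalOn S (prodOp w) := by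
  intro x hx B
  rw [siteOp_eq_prodOp, Commute, SemiconjBy, prodOp_mul, prodOp_mul]
  congr 1
  ext1 y
  by_cases h : y = x
  · subst h; simp [hw y hx]
  · simp [Function.update_of_ne h]

lemma localOn_siteOp (B : Matrix (Fin d) (Fin d) ℂ) (x : ZMod L) : LocalOn {x} (siteOp B x) := by
  rw [siteOp_eq_prodOp]
  exact localOn_prodOp fun y hy => Function.update_of_ne hy _ _

lemma localOn_embed (S : Finset (ZMod L)) (A : Matrix (S → Fin d) (S → Fin d) ℂ) :
    LocalOn (S : Set (ZMod L)) (embed S A) := by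
  intro x hx B
  ext f g
  rw [mul_siteOp_apply, siteOp_mul_apply]
  have hx' : ∀ y : S, (y : ZMod L) ≠ x := fun y h => hx (h ▸ y.2)
  have hu : ∀ (f : Config L d) a, (fun y : S => Function.update f x a y) = fun y : S => f y := by
    intro f a; ext1 y; rw [Function.update_of_ne (hx' y)]
  rw [Finset.sum_eq_single (f x), Finset.sum_eq_single (g x)]
  · rw [mul_comm]
    congr 1
    simp only [embed, Matrix.of_apply, hu]
    congr 1
    refine propext (forall₂_congr fun y _ => ?_)
    by_cases h : y = x
    · subst h; simp
    · simp [Function.update_of_ne h]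
  · intro a _ ha
    have : embed S A (Function.update f x a) g = 0 := by
      simp only [embed, Matrix.of_apply]
      rw [if_neg]
      intro h
      exact ha (by simpa using h x (by simpa using hx))
    simp [this]
  · simp
  · intro a _ ha
    have : embed S A f (Function.update g x a) = 0 := by
      simp only [embed, Matrix.of_apply]
      rw [if_neg]
      intro h
      exact ha (by simpa using (h x (by simpa using hx)).symm)
    simp [this]
  · simp

lemma embed_conjTranspose (S : Finset (ZMod L)) (A : Matrix (S → Fin d) (S → Fin d) ℂ) :
    (embed S A)ᴴ = embed S Aᴴ := by
  ext f g
  simp only [embed, Matrix.conjTranspose_apply, Matrix.of_apply, eq_comm (a := f _)]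
  split_ifs <;> simp

lemma embed_mul (S : Finset (ZMod L)) (A B : Matrix (S → Fin d) (S → Fin d) ℂ) :
    embed S A * embed S B = embed S (A * B) := by
  ext f g
  simp only [Matrix.mul_apply, embed, Matrix.of_apply]
  by_cases hfg : ∀ x, x ∉ S → f x = g x
  · rw [if_pos hfg]
    refine (Finset.sum_of_injOn
      (fun (k : S → Fin d) (x : ZMod L) => if h : x ∈ S then k ⟨x, h⟩ else f x)
      ?_ ?_ ?_ ?_).symm
    · intro k _ k' _ h
      ext1 y
      simpa using congrFun h y
    · simp
    · intro h _ hh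
      rw [if_neg, zero_mul]
      intro hc
      refine hh ⟨fun y => h y, by simp, ?_⟩
      ext1 x
      by_cases hx : x ∈ S <;> simp [hx, hc]
    · intro k _
      rw [if_pos (by simp +contextual), if_pos (by simpa +contextual using hfg)]
      simp
  · rw [if_neg hfg]
    refine Finset.sum_eq_zero fun h _ => ?_
    by_cases h1 : ∀ x, x ∉ S → f x = h x
    · rw [if_neg (c := ∀ x, x ∉ S → h x = g x), mul_zero]
      exact fun h2 => hfg fun x hx => (h1 x hx).trans (h2 x hx)
    · rw [if_neg h1, zero_mul]

lemma embed_one (S : Finset (ZMod L)) :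
    embed S (1 : Matrix (S → Fin d) (S → Fin d) ℂ) = 1 := by
  ext f g
  simp only [embed, Matrix.of_apply, Matrix.one_apply, funext_iff, ← ite_and]
  congr 1
  refine propext ⟨fun h x => ?_, fun h => ⟨fun x _ => h x, fun x => h x⟩⟩
  by_cases hx : x ∈ S
  · exact h.2 ⟨x, hx⟩
  · exact h.1 x hx

end Operators

section LightCones

variable {L d : ℕ}

/-! ### Light cones of circuits -/

/-- The sites at distance at most `r` from the set `S`, along the periodic chain. -/
def nbhd (r : ℕ) (S : Set (ZMod L)) : Set (ZMod L) :=
  {x | ∃ s ∈ S, ∃ k : ℤ, |k| ≤ r ∧ x = s + k}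

lemma nbhd_nbhd_subset (r r' : ℕ) (S : Set (ZMod L)) :
    nbhd r (nbhd r' S) ⊆ nbhd (r + r') S := by
  rintro x ⟨_, ⟨s, hs, k, hk, rfl⟩, k', hk', rfl⟩
  refine ⟨s, hs, k + k', ?_, by push_cast; ring⟩
  push_cast
  linarith [abs_add_le k k']

lemma subset_nbhd (r : ℕ) (S : Set (ZMod L)) : S ⊆ nbhd r S :=
  fun x hx => ⟨x, hx, 0, by simp, by simp⟩

lemma disjoint_nbhd_singleton {r : ℕ} {S : Set (ZMod L)} {x : ZMod L} (hx : x ∉ nbhd r S) :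
    Disjoint S (nbhd r {x}) := by
  rw [Set.disjoint_left]
  rintro _ hs ⟨_, rfl, k, hk, rfl⟩
  exact hx ⟨_, hs, -k, by simpa using hk, by push_cast; ring⟩

lemma bond_subset_nbhd {S : Set (ZMod L)} {x : ZMod L} (h : ¬ Disjoint (bond x : Set (ZMod L)) S) :
    (bond x : Set (ZMod L)) ⊆ nbhd 1 S := by
  rw [Set.not_disjoint_iff] at h
  obtain ⟨s, hs, hsS⟩ := h
  intro y hy
  simp only [bond, Finset.coe_insert, Finset.coe_singleton, Set.mem_insert_iff,
    Set.mem_singleton_iff] at hs hy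
  rcases hs with rfl | rfl <;> rcases hy with rfl | rfl
  · exact ⟨_, hsS, 0, by simp, by simp⟩
  · exact ⟨_, hsS, 1, by simp, by simp⟩
  · exact ⟨_, hsS, -1, by simp, by simp⟩
  · exact ⟨_, hsS, 0, by simp, by simp⟩

variable [NeZero L]

lemma embed_isometry {S : Finset (ZMod L)} (G : Matrix.unitaryGroup (S → Fin d) ℂ) :
    (embed S (G : Matrix _ _ ℂ))ᴴ * embed S (G : Matrix _ _ ℂ) = (1 : Op L d) := by
  rw [embed_conjTranspose, embed_mul, ← Matrix.star_eq_conjTranspose,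
    Matrix.UnitaryGroup.star_mul_self, embed_one]

lemma isometry_mul {V W : Op L d} (hV : Vᴴ * V = 1) (hW : Wᴴ * W = 1) :
    (V * W)ᴴ * (V * W) = 1 := by
  rw [Matrix.conjTranspose_mul, Matrix.mul_assoc, ← Matrix.mul_assoc Vᴴ, hV, Matrix.one_mul, hW]

/-- Conjugation by a product of disjoint gates enlarges a support by the gates that meet it. -/
lemma localOn_gates_conj {S : Set (ZMod L)} {A : Op L d} (hA : LocalOn S A)
    (gates : List ((x : ZMod L) × Matrix.unitaryGroup (bond x → Fin d) ℂ))
    (hg : gates.Pairwise (fun g h => Disjoint (bond g.1) (bond h.1))) {W : Op L d}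
    (hW : W = (gates.map fun g => embed (bond g.1) (g.2 : Matrix _ _ ℂ)).prod) :
    Wᴴ * W = 1 ∧
    LocalOn (S ∪ ⋃ g ∈ gates, {y | y ∈ bond g.1 ∧ ¬ Disjoint (bond g.1 : Set (ZMod L)) S})
      (W * A * Wᴴ) := by
  induction gates generalizing W with
  | nil =>
    subst hW
    simpa using hA
  | cons g gs ih =>
    rw [List.pairwise_cons] at hg
    obtain ⟨hW', hloc⟩ := ih hg.2 rfl
    set W' : Op L d := (gs.map fun g => embed (bond g.1)
      (g.2 : Matrix (bond g.1 → Fin d) (bond g.1 → Fin d) ℂ)).prod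
    set G : Op L d := embed (d := d) (bond g.1) (g.2 : Matrix _ _ ℂ) with hG
    have hWG : W = G * W' := by simpa using hW
    have hGi : Gᴴ * G = 1 := embed_isometry g.2
    have hGl : LocalOn (bond g.1 : Set (ZMod L)) G := localOn_embed _ _
    refine ⟨by rw [hWG]; exact isometry_mul hGi hW', ?_⟩
    have heq : W * A * Wᴴ = G * (W' * A * W'ᴴ) * Gᴴ := by
      rw [hWG, Matrix.conjTranspose_mul]; simp only [Matrix.mul_assoc]
    rw [heq]
    have hsub : (S ∪ ⋃ h ∈ gs, {y | y ∈ bond h.1 ∧ ¬ Disjoint (bond h.1 : Set (ZMod L)) S}) ⊆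
        S ∪ ⋃ h ∈ g :: gs, {y | y ∈ bond h.1 ∧ ¬ Disjoint (bond h.1 : Set (ZMod L)) S} := by
      refine Set.union_subset_union_right _ (Set.iUnion₂_subset fun h hh => ?_)
      exact Set.subset_iUnion₂_of_subset h (List.mem_cons_of_mem _ hh) subset_rfl
    by_cases hd : Disjoint (bond g.1 : Set (ZMod L)) S
    · -- The gate misses `S` and the other gates, so it commutes with the evolved operator.
      have hd' : Disjoint (bond g.1 : Set (ZMod L))
          (S ∪ ⋃ h ∈ gs, {y | y ∈ bond h.1 ∧ ¬ Disjoint (bond h.1 : Set (ZMod L)) S}) := by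
        rw [Set.disjoint_union_right]
        refine ⟨hd, ?_⟩
        rw [Set.disjoint_iUnion₂_right]
        intro h hh
        exact (Finset.disjoint_coe.2 (hg.1 h hh)).mono_right fun y hy => hy.1
      rw [(hGl.commute hloc hd').eq, Matrix.mul_assoc, mul_eq_one_comm.1 hGi, Matrix.mul_one]
      exact hloc.mono hsub
    · have hb : (bond g.1 : Set (ZMod L)) ⊆
          S ∪ ⋃ h ∈ g :: gs, {y | y ∈ bond h.1 ∧ ¬ Disjoint (bond h.1 : Set (ZMod L)) S} := by
        intro y hy
        refine Or.inr (Set.mem_iUnion₂.2 ⟨g, by simp, hy, hd⟩)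
      exact ((hGl.mono hb).mul (hloc.mono hsub)).mul (hGl.conjTranspose.mono hb)

lemma IsLayer.isometry {W : Op L d} (hW : IsLayer W) : Wᴴ * W = 1 := by
  obtain ⟨gates, hg, hW⟩ := hW
  exact (localOn_gates_conj (S := ∅) (A := 1) (fun _ _ _ => Commute.one_left _) gates hg hW).1

lemma IsLayer.localOn_conj {W : Op L d} (hW : IsLayer W) {S : Set (ZMod L)} {A : Op L d}
    (hA : LocalOn S A) : LocalOn (nbhd 1 S) (W * A * Wᴴ) := by
  obtain ⟨gates, hg, hW⟩ := hW
  refine (localOn_gates_conj hA gates hg hW).2.mono (Set.union_subset (subset_nbhd 1 S) ?_)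
  exact Set.iUnion₂_subset fun g _ y hy => bond_subset_nbhd hy.2 hy.1

lemma IsCircuit.isometry {t : ℕ} {V : Op L d} (hV : IsCircuit t V) : Vᴴ * V = 1 := by
  obtain ⟨layers, -, hl, rfl⟩ := hV
  induction layers with
  | nil => simp
  | cons W Ws ih =>
    rw [List.prod_cons]
    exact isometry_mul (hl W (by simp)).isometry (ih fun W' h => hl W' (by simp [h]))

lemma IsCircuit.localOn_conj {t : ℕ} {V : Op L d} (hV : IsCircuit t V) {S : Set (ZMod L)}
    {A : Op L d} (hA : LocalOn S A) : LocalOn (nbhd t S) (V * A * Vᴴ) := by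
  obtain ⟨layers, rfl, hl, rfl⟩ := hV
  induction layers with
  | nil => simpa using hA.mono (subset_nbhd 0 S)
  | cons W Ws ih =>
    have h := (hl W (by simp)).localOn_conj (ih fun W' h => hl W' (by simp [h]))
    rw [List.length_cons, add_comm]
    refine LocalOn.mono ?_ (nbhd_nbhd_subset 1 Ws.length S)
    rw [List.prod_cons, Matrix.conjTranspose_mul]
    simpa only [Matrix.mul_assoc] using h

/-- Locality of `Vᴴ A V` can be tested in the other direction: it commutes with a one-site operator
`B` as soon as `A` commutes with `V B Vᴴ`. -/
lemma localOn_conj_of_commute {V A : Op L d} (hV : Vᴴ * V = 1) {S : Set (ZMod L)}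
    (h : ∀ x ∉ S, ∀ B : Matrix (Fin d) (Fin d) ℂ, Commute A (V * siteOp B x * Vᴴ)) :
    LocalOn S (Vᴴ * A * V) := by
  intro x hx B
  calc Vᴴ * A * V * siteOp B x = Vᴴ * (A * (V * siteOp B x * Vᴴ)) * V := by
        simp only [Matrix.mul_assoc, hV, Matrix.mul_one]
    _ = Vᴴ * V * siteOp B x * (Vᴴ * A * V) := by
        rw [(h x hx B).eq]; simp only [Matrix.mul_assoc]
    _ = siteOp B x * (Vᴴ * A * V) := by rw [hV, Matrix.one_mul]

/-- The inverse circuit has the same light cones as the circuit. -/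
lemma IsCircuit.localOn_conj' {t : ℕ} {V : Op L d} (hV : IsCircuit t V) {S : Set (ZMod L)}
    {A : Op L d} (hA : LocalOn S A) : LocalOn (nbhd t S) (Vᴴ * A * V) :=
  localOn_conj_of_commute hV.isometry fun x hx B =>
    hA.commute (hV.localOn_conj (localOn_siteOp B x)) (disjoint_nbhd_singleton hx)

/-- The infimum defining the complexity is attained. -/
lemma exists_circuit_of_approxComplexity_eq [NeZero d] {δ : ℝ} {ψ : Hilb L d} {t : ℕ}
    (h : approxComplexity δ ψ = (t : ℕ∞)) :
    ∃ V : Op L d, IsCircuit t V ∧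
      traceNorm (ketbra ψ - ketbra (apply V (zeroState L d))) ≤ δ := by
  by_contra hne
  have hle : ((t + 1 : ℕ) : ℕ∞) ≤ approxComplexity δ ψ := by
    refine le_iInf₂ fun s hs => ?_
    have h1 : (t : ℕ∞) ≤ s := h ▸ iInf₂_le s hs
    have h2 : s ≠ t := fun h => hne (h ▸ hs)
    have h1' : t ≤ s := by exact_mod_cast h1
    exact_mod_cast (by omega : t + 1 ≤ s)
  rw [h] at hle
  have : t + 1 ≤ t := by exact_mod_cast hle
  omega

/-! ### Trace norm and overlap -/

lemma inner_eq_sum (ψ φ : Hilb L d) : inner ℂ ψ φ = ∑ f, star (ψ f) * φ f := by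
  simp [PiLp.inner_apply, mul_comm]

lemma trace_ketbra_mul (ψ φ : Hilb L d) :
    (ketbra ψ * ketbra φ).trace = inner ℂ ψ φ * inner ℂ φ ψ := by
  rw [ketbra, ketbra, Matrix.vecMulVec_mul_vecMulVec, Matrix.trace_vecMulVec, inner_eq_sum,
    inner_eq_sum]
  simp only [dotProduct, Pi.star_apply, Pi.smul_apply, smul_eq_mul, Finset.mul_sum]
  refine Finset.sum_congr rfl fun f _ => ?_
  ring

open scoped ComplexOrder in
/-- The trace norm dominates the Hilbert–Schmidt norm. -/
lemma re_trace_le_traceNorm_sq (A : Op L d) : (Aᴴ * A).trace.re ≤ traceNorm A ^ 2 := by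
  have hA := Matrix.isHermitian_conjTranspose_mul_self A
  have hnn : ∀ i, 0 ≤ hA.eigenvalues i := (Matrix.posSemidef_conjTranspose_mul_self A).eigenvalues_nonneg
  rw [hA.trace_eq_sum_eigenvalues]
  have h := Finset.sum_sq_le_sq_sum_of_nonneg (s := Finset.univ)
    (f := fun i => √(hA.eigenvalues i)) (fun i _ => Real.sqrt_nonneg _)
  simpa [Real.sq_sqrt, hnn, traceNorm] using h

lemma traceNorm_nonneg (A : Op L d) : 0 ≤ traceNorm A :=
  Finset.sum_nonneg fun _ _ => Real.sqrt_nonneg _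

/-- Unit vectors whose projectors are close in trace norm are close up to a phase. -/
lemma exists_phase_norm_sub_le {δ : ℝ} {ψ φ : Hilb L d} (hψ : ‖ψ‖ = 1) (hφ : ‖φ‖ = 1)
    (h : traceNorm (ketbra ψ - ketbra φ) ≤ δ) : ∃ c : ℂ, ‖c‖ = 1 ∧ ‖φ - c • ψ‖ ≤ δ := by
  have h1 : 2 - 2 * ‖inner ℂ ψ φ‖ ^ 2 ≤ δ ^ 2 := by
    refine le_trans (le_of_eq ?_) ((re_trace_le_traceNorm_sq _).trans
      (pow_le_pow_left₀ (traceNorm_nonneg _) h 2))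
    have hh : ∀ χ : Hilb L d, (ketbra χ)ᴴ = ketbra χ := by
      intro χ
      simp [ketbra, Matrix.conjTranspose_vecMulVec]
    rw [Matrix.conjTranspose_sub, hh, hh, Matrix.sub_mul, Matrix.mul_sub, Matrix.mul_sub]
    simp only [Matrix.trace_sub, trace_ketbra_mul, inner_self_eq_norm_sq_to_K, hψ, hφ]
    rw [← inner_conj_symm φ ψ, mul_comm ((starRingEnd ℂ) _), Complex.mul_conj,
      Complex.normSq_eq_norm_sq]
    have hr (r : ℝ) : ((r : ℂ) ^ 2).re = r ^ 2 := by rw [← Complex.ofReal_pow, Complex.ofReal_re]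
    simp [hr]
    ring
  have hle : ‖inner ℂ ψ φ‖ ≤ 1 := by simpa [hψ, hφ] using norm_inner_le_norm (𝕜 := ℂ) ψ φ
  obtain ⟨c, hc, hcz⟩ : ∃ c : ℂ, ‖c‖ = 1 ∧ inner ℂ ψ φ = ‖inner ℂ ψ φ‖ * c := by
    by_cases h0 : inner ℂ ψ φ = 0
    · exact ⟨1, by simp, by simp [h0]⟩
    · have hn : (‖inner ℂ ψ φ‖ : ℂ) ≠ 0 := by simpa using h0
      refine ⟨inner ℂ ψ φ / ‖inner ℂ ψ φ‖, by simp [h0], by field_simp⟩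
  refine ⟨c, hc, ?_⟩
  have hδ : 0 ≤ δ := (traceNorm_nonneg _).trans h
  refine (sq_le_sq₀ (norm_nonneg _) hδ).1 (le_trans ?_ h1)
  have hsq : ‖φ - c • ψ‖ ^ 2 = 2 - 2 * ‖inner ℂ ψ φ‖ := by
    have hre : RCLike.re (inner ℂ φ (c • ψ)) = ‖inner ℂ ψ φ‖ := by
      have hcc : c * (starRingEnd ℂ) c = 1 := by
        rw [Complex.mul_conj, Complex.normSq_eq_norm_sq, hc]; simp
      have : inner ℂ φ (c • ψ) = (‖inner ℂ ψ φ‖ : ℂ) := by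
        rw [inner_smul_right, ← inner_conj_symm φ ψ]
        nth_rewrite 1 [hcz]
        rw [RingHom.map_mul, Complex.conj_ofReal, mul_left_comm, hcc, mul_one]
      rw [this]
      exact Complex.ofReal_re _
    rw [@norm_sub_sq ℂ, hre, norm_smul, hc, hψ, hφ]
    ring
  rw [hsq]
  nlinarith [norm_nonneg (inner ℂ ψ φ)]

end LightCones

section Twist

variable {L d : ℕ}

/-! ### The one-site twist -/

open scoped Matrix.Norms.L2Operator in
lemma map_exp_matrix {m n : Type*} [Fintype m] [DecidableEq m] [Fintype n] [DecidableEq n]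
    (F : Matrix m m ℂ →+* Matrix n n ℂ) (hF : Continuous F) (A : Matrix m m ℂ) :
    F (NormedSpace.exp A) = NormedSpace.exp (F A) := by
  let : NormedAlgebra ℚ (Matrix m m ℂ) := NormedAlgebra.restrictScalars ℚ ℂ _
  exact NormedSpace.map_exp F (by exact hF) A

section OneSite

open scoped Matrix.Norms.L2Operator

lemma norm_zpow_sub_one_le (v : Matrix.unitaryGroup (Fin d) ℂ) (k : ℤ) :
    ‖((v ^ k : Matrix.unitaryGroup (Fin d) ℂ) : Matrix (Fin d) (Fin d) ℂ) - 1‖ ≤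
      |(k : ℝ)| * ‖(v : Matrix (Fin d) (Fin d) ℂ) - 1‖ := by
  have hnat : ∀ n : ℕ, ‖((v ^ n : Matrix.unitaryGroup (Fin d) ℂ) : Matrix (Fin d) (Fin d) ℂ) - 1‖ ≤
      n * ‖(v : Matrix (Fin d) (Fin d) ℂ) - 1‖ := by
    intro n
    induction n with
    | zero => simp
    | succ n ih =>
      have : ((v ^ (n + 1) : Matrix.unitaryGroup (Fin d) ℂ) : Matrix (Fin d) (Fin d) ℂ) - 1 =
          ((v ^ n : Matrix.unitaryGroup (Fin d) ℂ) : Matrix (Fin d) (Fin d) ℂ) * (v - 1) +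
            (((v ^ n : Matrix.unitaryGroup (Fin d) ℂ) : Matrix (Fin d) (Fin d) ℂ) - 1) := by
        rw [pow_succ]; simp [mul_sub]
      rw [this]
      refine (norm_add_le _ _).trans ?_
      rw [CStarRing.norm_coe_unitary_mul]
      rw [Nat.cast_add_one, add_one_mul, add_comm]
      gcongr
  obtain ⟨n, rfl | rfl⟩ := Int.eq_nat_or_neg k
  · simpa using hnat n
  · have : ((v ^ (-(n : ℤ)) : Matrix.unitaryGroup (Fin d) ℂ) : Matrix (Fin d) (Fin d) ℂ) - 1 =
        ((v ^ (-(n : ℤ)) : Matrix.unitaryGroup (Fin d) ℂ) : Matrix (Fin d) (Fin d) ℂ) *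
          (1 - ((v ^ n : Matrix.unitaryGroup (Fin d) ℂ) : Matrix (Fin d) (Fin d) ℂ)) := by
      rw [mul_sub, mul_one, ← Submonoid.coe_mul, zpow_neg, zpow_natCast, inv_mul_cancel]
      simp
    rw [this, CStarRing.norm_coe_unitary_mul, norm_sub_rev]
    simpa using hnat n

/-- For a Hermitian `q` with integer spectrum, `exp (2πi q / L)` is a unitary of order dividing
`L`, at distance at most `2π ‖q‖ / L` from the identity. -/
lemma exists_twist [NeZero L] {q : Matrix (Fin d) (Fin d) ℂ} (hq : q.IsHermitian)
    (hq_int : ∀ μ ∈ spectrum ℂ q, ∃ k : ℤ, μ = (k : ℂ)) :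
    ∃ v : Matrix.unitaryGroup (Fin d) ℂ,
      (v : Matrix (Fin d) (Fin d) ℂ) =
        NormedSpace.exp ((2 * (Real.pi : ℂ) * Complex.I / (L : ℂ)) • q) ∧
      v ^ L = 1 ∧
      ‖(v : Matrix (Fin d) (Fin d) ℂ) - 1‖ ≤ 2 * Real.pi / L * opNorm q := by
  have hL : (L : ℂ) ≠ 0 := Nat.cast_ne_zero.2 (NeZero.ne L)
  set D := Unitary.conjStarAlgAut ℂ _ hq.eigenvectorUnitary with hD
  set e : Fin d → ℂ := fun i =>
    Complex.exp (Complex.I * ((2 * Real.pi / L * hq.eigenvalues i : ℝ) : ℂ)) with he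
  have hexp : NormedSpace.exp ((2 * (Real.pi : ℂ) * Complex.I / (L : ℂ)) • q) =
      D (Matrix.diagonal e) := by
    nth_rewrite 1 [hq.spectral_theorem]
    rw [← map_smul, ← Matrix.diagonal_smul]
    have hcont : Continuous (D : Matrix (Fin d) (Fin d) ℂ → Matrix (Fin d) (Fin d) ℂ) := by
      have : (D : Matrix (Fin d) (Fin d) ℂ → Matrix (Fin d) (Fin d) ℂ) = fun M =>
        (hq.eigenvectorUnitary : Matrix (Fin d) (Fin d) ℂ) * M *
          star (hq.eigenvectorUnitary : Matrix (Fin d) (Fin d) ℂ) := by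
        ext1 M; rw [hD, Unitary.conjStarAlgAut_apply]
      rw [this]
      fun_prop
    refine (map_exp_matrix (D : Matrix (Fin d) (Fin d) ℂ →+* Matrix (Fin d) (Fin d) ℂ)
      hcont _).symm.trans ?_
    rw [Matrix.exp_diagonal]
    simp only [RingHom.coe_coe]
    congr 2
    ext1 i
    rw [Pi.coe_exp, ← Complex.exp_eq_exp_ℂ, he]
    simp
    congr 1
    ring
  have hmem : ∀ i, (hq.eigenvalues i : ℂ) ∈ spectrum ℂ q := by
    intro i
    have := hq.eigenvalues_mem_spectrum_real i
    rwa [← spectrum.algebraMap_mem_iff ℂ] at this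
  have hpow : Matrix.diagonal e ^ L = 1 := by
    rw [Matrix.diagonal_pow, ← Matrix.diagonal_one]
    congr 1
    ext1 i
    obtain ⟨k, hk⟩ := hq_int _ (hmem i)
    rw [Pi.pow_apply, he, ← Complex.exp_nat_mul]
    refine Complex.exp_eq_one_iff.2 ⟨k, ?_⟩
    push_cast
    rw [hk]
    field_simp
  have hstar : Matrix.diagonal e ∈ Matrix.unitaryGroup (Fin d) ℂ := by
    rw [Matrix.mem_unitaryGroup_iff, Matrix.star_eq_conjTranspose, Matrix.diagonal_conjTranspose,
      Matrix.diagonal_mul_diagonal, ← Matrix.diagonal_one]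
    congr 1
    ext1 i
    rw [Pi.star_apply, RCLike.star_def, Complex.mul_conj, Complex.normSq_eq_norm_sq]
    simp only [he]
    rw [mul_comm Complex.I, Complex.norm_exp_ofReal_mul_I]
    simp
  refine ⟨⟨D (Matrix.diagonal e), ?_⟩, hexp.symm, ?_, ?_⟩
  · rw [Matrix.mem_unitaryGroup_iff, ← map_star, ← map_mul, Matrix.mem_unitaryGroup_iff.1 hstar,
      map_one]
  · ext1
    rw [SubmonoidClass.coe_pow]
    simp only
    rw [← map_pow, hpow, map_one]
    rfl
  · have h1 : D (Matrix.diagonal e) - 1 = D (Matrix.diagonal fun i => e i - 1) := by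
      rw [← Matrix.diagonal_sub, map_sub]
      congr 1
      rw [show (Matrix.diagonal fun _ : Fin d => (1 : ℂ)) = 1 from Matrix.diagonal_one, map_one]
    simp only
    rw [h1, hD, Unitary.conjStarAlgAut_apply, ← Unitary.coe_star, CStarRing.norm_mul_coe_unitary,
      CStarRing.norm_coe_unitary_mul, Matrix.l2_opNorm_diagonal]
    refine (pi_norm_le_iff_of_nonneg (by unfold opNorm; positivity)).2 fun i => ?_
    refine Real.norm_exp_I_mul_ofReal_sub_one_le.trans ?_
    rw [norm_mul, Real.norm_of_nonneg (by positivity)]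
    refine mul_le_mul_of_nonneg_left ?_ (by positivity)
    have : Nonempty (Fin d) := ⟨i⟩
    have := spectrum.norm_le_norm_of_mem (hmem i)
    rwa [Complex.norm_real] at this

lemma zpow_eq_zpow_of_cast_eq {v : Matrix.unitaryGroup (Fin d) ℂ} (hv : v ^ L = 1) {a b : ℤ}
    (h : (a : ZMod L) = b) : v ^ a = v ^ b := by
  obtain ⟨c, hc⟩ := (ZMod.intCast_eq_intCast_iff_dvd_sub a b L).1 h
  rw [show b = a + L * c by omega, zpow_add, zpow_mul, zpow_natCast, hv, one_zpow, mul_one]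

end OneSite

variable [NeZero L]

/-! ### Translation and the total charge -/

lemma translation_mul_apply (A : Op L d) (f g : Config L d) :
    (translation L d * A) f g = A (fun x => f (x + 1)) g := by
  rw [Matrix.mul_apply, Finset.sum_eq_single fun x => f (x + 1)]
  · simp [translation]
  · intro h _ hne
    rw [translation, Matrix.of_apply, if_neg fun hh => hne (funext fun x => (hh x).symm), zero_mul]
  · simp

lemma mul_translation_apply (A : Op L d) (f g : Config L d) :
    (A * translation L d) f g = A f (fun x => g (x - 1)) := by
  rw [Matrix.mul_apply, Finset.sum_eq_single fun x => g (x - 1)]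
  · simp [translation]
  · intro h _ hne
    rw [translation, Matrix.of_apply, if_neg, mul_zero]
    exact fun hh => hne (funext fun x => by rw [← hh (x - 1), sub_add_cancel])
  · simp

lemma translation_isometry : (translation L d)ᴴ * translation L d = 1 := by
  ext f g
  rw [mul_translation_apply, Matrix.conjTranspose_apply, translation, Matrix.of_apply,
    Matrix.one_apply]
  simp only [add_sub_cancel_right, funext_iff, eq_comm (a := f _)]
  split_ifs <;> simp

lemma translation_mul_prodOp (w : ZMod L → Matrix (Fin d) (Fin d) ℂ) :
    translation L d * prodOp w = prodOp (fun x => w (x - 1)) * translation L d := by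
  ext f g
  rw [translation_mul_apply, mul_translation_apply]
  simp only [prodOp, Matrix.of_apply]
  exact Fintype.prod_equiv (Equiv.addRight 1) _ _ (by simp)

/-- The unitary generated by the total charge is a product operator. -/
lemma exp_totalCharge (c : ℂ) (q : Matrix (Fin d) (Fin d) ℂ) :
    NormedSpace.exp (c • totalCharge L q) = prodOp fun _ => NormedSpace.exp (c • q) := by
  have key : ∀ s : Finset (ZMod L), NormedSpace.exp (c • ∑ x ∈ s, siteOp q x : Op L d) =
      prodOp fun x => if x ∈ s then NormedSpace.exp (c • q) else 1 := by
    intro s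
    induction s using Finset.induction_on with
    | empty => simp [prodOp_one]
    | insert y s hy ih =>
      have hcomm : Commute (c • siteOp q y : Op L d) (c • ∑ x ∈ s, siteOp q x) := by
        refine Commute.smul_left (Commute.smul_right (Commute.sum_right _ _ _ fun x hx => ?_) _) _
        exact localOn_siteOp q y x (fun h => hy (h ▸ hx)) q
      rw [Finset.sum_insert hy, smul_add, Matrix.exp_add_of_commute _ _ hcomm, ih,
        ← siteHom_apply, ← map_smul]
      have hexp : NormedSpace.exp (siteHom L d y (c • q)) = siteOp (NormedSpace.exp (c • q)) y :=
        (map_exp_matrix (siteHom L d y : Matrix (Fin d) (Fin d) ℂ →+* Op L d)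
          (continuous_siteHom y) (c • q)).symm
      rw [hexp, siteOp_eq_prodOp, prodOp_mul]
      congr 1
      ext1 x
      by_cases h : x = y
      · subst h; simp [hy]
      · simp [h]
  rw [totalCharge, key]
  simp

/-! ### The twist operator -/

/-- The product operator built from unitaries on each site. -/
def unitaryProd (w : ZMod L → Matrix.unitaryGroup (Fin d) ℂ) : Op L d :=
  prodOp fun x => (w x : Matrix (Fin d) (Fin d) ℂ)

lemma unitaryProd_mul (w w' : ZMod L → Matrix.unitaryGroup (Fin d) ℂ) :
    unitaryProd w * unitaryProd w' = unitaryProd fun x => w x * w' x := by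
  simp [unitaryProd, prodOp_mul]

lemma unitaryProd_isometry (w : ZMod L → Matrix.unitaryGroup (Fin d) ℂ) :
    (unitaryProd w)ᴴ * unitaryProd w = 1 :=
  prodOp_isometry fun x => by
    rw [← Matrix.star_eq_conjTranspose, Matrix.UnitaryGroup.star_mul_self]

/-- The Lieb–Schultz–Mattis twist `⨂ₓ v ^ x`, with the sites labelled `0, …, L - 1`. -/
def twist (L : ℕ) [NeZero L] (v : Matrix.unitaryGroup (Fin d) ℂ) : Op L d :=
  unitaryProd fun x => v ^ (x.val : ℤ)

/-- The twist changes the momentum of a translation invariant state of non-commensurate filling,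
so the twisted state is orthogonal to the original one. -/
lemma inner_twist_eq_zero {v : Matrix.unitaryGroup (Fin d) ℂ} (hv : v ^ L = 1) {ψ : Hilb L d}
    (hψ : ‖ψ‖ = 1) {c μ : ℂ} (hT : apply (translation L d) ψ = c • ψ)
    (hE : apply (unitaryProd fun _ => v) ψ = μ • ψ) (hμ : μ ≠ 1) :
    inner ℂ ψ (apply (twist L v) ψ) = 0 := by
  set S : Op L d := unitaryProd fun x => v ^ ((x - 1).val : ℤ) with hS
  have hTU : translation L d * twist L v = S * translation L d := by
    rw [twist, unitaryProd, translation_mul_prodOp]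
    rfl
  have hU : twist L v = S * unitaryProd fun _ => v := by
    rw [hS, unitaryProd_mul, twist]
    congr 1
    ext1 x
    rw [← zpow_add_one]
    exact zpow_eq_zpow_of_cast_eq hv (by simp)
  have hc : ‖c‖ = 1 := by
    have := norm_apply_of_isometry translation_isometry ψ
    rwa [hT, norm_smul, hψ, mul_one] at this
  have h1 : inner ℂ ψ (apply (twist L v) ψ) = inner ℂ ψ (apply S ψ) := by
    rw [← inner_apply_apply translation_isometry ψ, ← apply_mul, hTU, apply_mul, hT, apply_smul,
      inner_smul_left, inner_smul_right, ← mul_assoc, mul_comm _ c, Complex.mul_conj,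
      Complex.normSq_eq_norm_sq, hc]
    simp
  have h2 : inner ℂ ψ (apply (twist L v) ψ) = μ * inner ℂ ψ (apply S ψ) := by
    rw [hU, apply_mul, hE, apply_smul, inner_smul_right]
  have h3 : (μ - 1) * inner ℂ ψ (apply (twist L v) ψ) = 0 := by
    rw [sub_mul, one_mul]
    nth_rewrite 2 [h2]
    rw [h1, sub_self]
  exact (mul_eq_zero.1 h3).resolve_left (sub_ne_zero.2 hμ)

lemma apply_unitaryProd_pow {v : Matrix.unitaryGroup (Fin d) ℂ} {ψ : Hilb L d} {μ : ℂ}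
    (hE : apply (unitaryProd fun _ => v) ψ = μ • ψ) (a : ℕ) :
    apply (unitaryProd fun _ => v ^ (a : ℤ)) ψ = μ ^ a • ψ := by
  induction a with
  | zero =>
    have : (unitaryProd fun _ : ZMod L => v ^ ((0 : ℕ) : ℤ)) = 1 := by
      simp [unitaryProd, prodOp_one]
    rw [this, apply_one, pow_zero, one_smul]
  | succ a ih =>
    have : (unitaryProd fun _ : ZMod L => v ^ ((a + 1 : ℕ) : ℤ)) =
        unitaryProd (fun _ => v ^ (a : ℤ)) * unitaryProd fun _ => v := by
      rw [unitaryProd_mul]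
      simp [zpow_add_one]
    rw [this, apply_mul, hE, apply_smul, ih, smul_smul, pow_succ']

open scoped Matrix.Norms.L2Operator in
lemma norm_apply_siteOp_le (B : Matrix (Fin d) (Fin d) ℂ) (x : ZMod L) (φ : Hilb L d) :
    ‖apply (siteOp B x) φ‖ ≤ ‖B‖ * ‖φ‖ := by
  refine (Matrix.l2_opNorm_mulVec (siteOp B x) φ).trans ?_
  exact mul_le_mul_of_nonneg_right (NonUnitalStarAlgHom.norm_apply_le (siteHom L d x) B)
    (norm_nonneg _)

open scoped Matrix.Norms.L2Operator in
/-- A product of one-site unitaries moves a vector by at most the sum of the distances of its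
factors from the identity. -/
lemma norm_apply_unitaryProd_sub_le (w : ZMod L → Matrix.unitaryGroup (Fin d) ℂ)
    (R : Finset (ZMod L)) {φ : Hilb L d} (hφ : ‖φ‖ = 1) :
    ‖apply (unitaryProd fun x => if x ∈ R then w x else 1) φ - φ‖ ≤
      ∑ x ∈ R, ‖(w x : Matrix (Fin d) (Fin d) ℂ) - 1‖ := by
  induction R using Finset.induction_on with
  | empty => simp [unitaryProd, prodOp_one, apply_one]
  | insert y R hy ih =>
    set B := unitaryProd fun x => if x ∈ R then w x else 1
    set A : Op L d := siteOp (w y : Matrix (Fin d) (Fin d) ℂ) y with hA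
    have hAB : (unitaryProd fun x => if x ∈ insert y R then w x else 1) = A * B := by
      rw [hA, siteOp_eq_prodOp]
      simp only [B, unitaryProd, prodOp_mul]
      congr 1
      ext1 x
      by_cases h : x = y
      · subst h; simp [hy]
      · simp [h]
    have hAi : Aᴴ * A = 1 := by
      rw [hA, siteOp_eq_prodOp]
      refine prodOp_isometry fun x => ?_
      by_cases h : x = y
      · subst h
        rw [Function.update_self, ← Matrix.star_eq_conjTranspose,
          Matrix.UnitaryGroup.star_mul_self]
      · simp [Function.update_of_ne h]
    have hA1 : apply A φ - φ = apply (siteOp ((w y : Matrix (Fin d) (Fin d) ℂ) - 1) y) φ := by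
      rw [← siteHom_apply, map_sub, map_one, apply_sub, apply_one]
      rfl
    have heq : apply (A * B) φ - φ = (apply A φ - φ) + apply A (apply B φ - φ) := by
      rw [apply_mul, apply_vec_sub]; abel
    rw [hAB, heq, Finset.sum_insert hy]
    refine (norm_add_le _ _).trans (add_le_add ?_ ?_)
    · rw [hA1]
      simpa [hφ] using norm_apply_siteOp_le ((w y : Matrix (Fin d) (Fin d) ℂ) - 1) y φ
    · rw [norm_apply_of_isometry hAi]
      exact ih

open scoped Matrix.Norms.L2Operator in
/-- Seen from a region `R` around the site `a`, the twist of a charge eigenstate is the same as the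
twist centred at `a` and restricted to `R`, which is close to the identity. The contraction `A`
is local to `R` and annihilates `φ`, and `φ` is `δ`-close to the charge eigenstate `ψ`. -/
lemma norm_local_apply_twist_le {v : Matrix.unitaryGroup (Fin d) ℂ} {ψ φ : Hilb L d} {c μ : ℂ}
    {δ : ℝ} (hφ : ‖φ‖ = 1) (hδ : ‖φ - c • ψ‖ ≤ δ) (hμ : ‖μ‖ = 1)
    (hE : apply (unitaryProd fun _ => v) ψ = μ • ψ) {R : Finset (ZMod L)} {A : Op L d}
    (hA : LocalOn (R : Set (ZMod L)) A) (hA1 : ∀ ξ, ‖apply A ξ‖ ≤ ‖ξ‖) (hA0 : apply A φ = 0)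
    (a : ℕ) :
    ‖apply A (apply (twist L v) φ)‖ ≤
      (∑ x ∈ R, ‖((v ^ ((x.val : ℤ) - a) : Matrix.unitaryGroup (Fin d) ℂ) :
        Matrix (Fin d) (Fin d) ℂ) - 1‖) + 2 * δ := by
  set r : Op L d := unitaryProd fun x => if x ∈ R then 1 else v ^ ((x.val : ℤ) - a) with hr
  set l : Op L d := unitaryProd fun x => if x ∈ R then v ^ ((x.val : ℤ) - a) else 1 with hl
  have hU : twist L v = r * l * unitaryProd fun _ => v ^ (a : ℤ) := by
    rw [hr, hl, unitaryProd_mul, unitaryProd_mul, twist]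
    congr 1
    ext1 x
    by_cases h : x ∈ R <;> simp [h, zpow_sub]
  have hrl : LocalOn ((R : Set (ZMod L))ᶜ) r := by
    refine localOn_prodOp fun x hx => ?_
    have : x ∈ R := by simpa using hx
    simp [this]
  have hcomm : A * r = r * A := (hA.commute hrl disjoint_compl_right).eq
  have hψ' : ‖apply A (apply (twist L v) (c • ψ))‖ = ‖apply A (apply l (c • ψ))‖ := by
    rw [hU, apply_mul, apply_smul, apply_unitaryProd_pow hE, smul_comm, apply_smul, apply_smul,
      norm_smul, norm_pow, hμ, one_pow, one_mul, apply_mul, ← apply_mul, hcomm, apply_mul,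
      norm_apply_of_isometry (unitaryProd_isometry _)]
  have h1 : ‖apply A (apply (twist L v) (φ - c • ψ))‖ ≤ δ := by
    refine (hA1 _).trans ?_
    rw [twist, norm_apply_of_isometry (unitaryProd_isometry _)]
    exact hδ
  have h2 : ‖apply A (apply l (φ - c • ψ))‖ ≤ δ := by
    refine (hA1 _).trans ?_
    rw [norm_apply_of_isometry (unitaryProd_isometry _)]
    exact hδ
  have h3 : ‖apply A (apply l φ)‖ ≤ ∑ x ∈ R,
      ‖((v ^ ((x.val : ℤ) - a) : Matrix.unitaryGroup (Fin d) ℂ) :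
        Matrix (Fin d) (Fin d) ℂ) - 1‖ := by
    have : apply A (apply l φ) = apply A (apply l φ - φ) := by rw [apply_vec_sub, hA0, sub_zero]
    rw [this]
    exact (hA1 _).trans (norm_apply_unitaryProd_sub_le _ R hφ)
  rw [apply_vec_sub, apply_vec_sub] at h1 h2
  have h4 := norm_le_norm_add_norm_sub' (apply A (apply (twist L v) φ))
    (apply A (apply (twist L v) (c • ψ)))
  have h5 := norm_le_norm_add_norm_sub (apply A (apply l φ)) (apply A (apply l (c • ψ)))
  rw [hψ'] at h4
  linarith

lemma sum_abs_Ico (m n : ℕ) :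
    ∑ k ∈ Finset.Ico (-(m : ℤ)) n, |(k : ℝ)| = m * (m + 1) / 2 + n * (n - 1) / 2 := by
  induction n with
  | zero =>
    induction m with
    | zero => simp
    | succ m ih =>
      have : Finset.Ico (-((m + 1 : ℕ) : ℤ)) ((0 : ℕ) : ℤ) =
          insert (-((m + 1 : ℕ) : ℤ)) (Finset.Ico (-(m : ℤ)) ((0 : ℕ) : ℤ)) := by
        ext k; simp only [Finset.mem_Ico, Finset.mem_insert]; omega
      rw [this, Finset.sum_insert (by simp), ih]
      push_cast
      rw [abs_neg, abs_of_nonneg (by positivity)]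
      ring
  | succ n ih =>
    have : Finset.Ico (-(m : ℤ)) ((n + 1 : ℕ) : ℤ) =
        insert (n : ℤ) (Finset.Ico (-(m : ℤ)) (n : ℤ)) := by
      ext k; simp only [Finset.mem_Ico, Finset.mem_insert]; omega
    rw [this, Finset.sum_insert (by simp), ih]
    push_cast
    rw [abs_of_nonneg (by positivity)]
    ring

open scoped Matrix.Norms.L2Operator in
/-- The cost of the twist centred at `a` on the region `[a - t, a + 2t)`. -/
lemma sum_norm_twist_le {v : Matrix.unitaryGroup (Fin d) ℂ} (hv : v ^ L = 1) (a t : ℕ) :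
    (∑ x ∈ (Finset.Ico (-(t : ℤ)) ((2 * t : ℕ) : ℤ)).image fun k : ℤ => (((a : ℤ) + k : ℤ) : ZMod L),
      ‖((v ^ ((x.val : ℤ) - a) : Matrix.unitaryGroup (Fin d) ℂ) :
        Matrix (Fin d) (Fin d) ℂ) - 1‖) ≤
      5 / 2 * (t : ℝ) ^ 2 * ‖(v : Matrix (Fin d) (Fin d) ℂ) - 1‖ := by
  refine (Finset.sum_image_le_of_nonneg ?_).trans ?_
  · exact fun _ _ => norm_nonneg _
  have h1 : ∀ k : ℤ, v ^ (((((a : ℤ) + k : ℤ) : ZMod L).val : ℤ) - a) = v ^ k := by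
    intro k
    refine zpow_eq_zpow_of_cast_eq hv ?_
    push_cast
    simp
  calc _ ≤ ∑ k ∈ Finset.Ico (-(t : ℤ)) ((2 * t : ℕ) : ℤ),
        |(k : ℝ)| * ‖(v : Matrix (Fin d) (Fin d) ℂ) - 1‖ := by
        refine Finset.sum_le_sum fun k _ => ?_
        rw [h1]
        exact norm_zpow_sub_one_le v k
    _ ≤ _ := by
        rw [← Finset.sum_mul, sum_abs_Ico]
        refine mul_le_mul_of_nonneg_right ?_ (norm_nonneg _)
        push_cast
        nlinarith [(Nat.cast_nonneg t : (0 : ℝ) ≤ t)]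

end Twist

/-! ### The Lovász local lemma -/

section LocalLemma

variable {ι Ω : Type*} [Fintype Ω]

/-- The total weight of an event in a finite weighted space. -/
def weight (p : Ω → ℝ) (E : Set Ω) : ℝ := ∑ ω, E.indicator p ω

/-- The event that none of the bad events with index in `S` occurs. -/
def avoid (bad : ι → Set Ω) (S : Finset ι) : Set Ω := {ω | ∀ i ∈ S, ω ∉ bad i}

lemma weight_nonneg {p : Ω → ℝ} (hp : ∀ ω, 0 ≤ p ω) (E : Set Ω) : 0 ≤ weight p E :=
  Finset.sum_nonneg fun _ _ => Set.indicator_nonneg (fun ω _ => hp ω) _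

lemma weight_mono {p : Ω → ℝ} (hp : ∀ ω, 0 ≤ p ω) {E F : Set Ω} (h : E ⊆ F) :
    weight p E ≤ weight p F :=
  Finset.sum_le_sum fun ω _ => Set.indicator_le_indicator_of_subset h hp ω

variable [DecidableEq ι]

lemma weight_avoid_eq_add (p : Ω → ℝ) (bad : ι → Set Ω) (S : Finset ι) (j : ι) :
    weight p (avoid bad S) =
      weight p (avoid bad (insert j S)) + weight p (bad j ∩ avoid bad S) := by
  classical
  rw [weight, weight, weight, ← Finset.sum_add_distrib]
  refine Finset.sum_congr rfl fun ω _ => ?_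
  by_cases h1 : ω ∈ bad j <;> by_cases h2 : ∀ i ∈ S, ω ∉ bad i <;>
    simp [Set.indicator_apply, avoid, h1, h2]

/-- The symmetric Lovász local lemma for a weighted space. The independence hypothesis is
one-sided: given that remote bad events are avoided, each bad event has conditional probability at
most `P`. -/
theorem lovasz_local_lemma {p : Ω → ℝ} (hp : ∀ ω, 0 ≤ p ω) (bad : ι → Set Ω) (N : ι → Finset ι)
    {D : ℕ} (hN : ∀ j, (N j).card ≤ D) {P x : ℝ} (hx0 : 0 ≤ x) (hx1 : x ≤ 1)
    (hP : P ≤ x * (1 - x) ^ D)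
    (hind : ∀ j (S : Finset ι), Disjoint S (N j) →
      weight p (bad j ∩ avoid bad S) ≤ P * weight p (avoid bad S)) (S : Finset ι) :
    (1 - x) ^ S.card * weight p Set.univ ≤ weight p (avoid bad S) := by
  have key : ∀ (n : ℕ) (S : Finset ι), S.card = n → ∀ j ∉ S,
      (1 - x) * weight p (avoid bad S) ≤ weight p (avoid bad (insert j S)) := by
    intro n
    induction n using Nat.strong_induction_on with
    | _ n ih =>
      intro S hS j hj
      -- Adding back the neighbours of `j` one at a time only loses a factor `1 - x` for each.
      have hadd : ∀ R ⊆ S ∩ N j, (1 - x) ^ R.card * weight p (avoid bad (S \ N j)) ≤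
          weight p (avoid bad (R ∪ S \ N j)) := by
        intro R
        induction R using Finset.induction_on with
        | empty => simp
        | insert a R ha ihR =>
          intro hR
          rw [Finset.insert_subset_iff] at hR
          have haS := Finset.mem_inter.1 hR.1
          have hnot : a ∉ R ∪ S \ N j := by simp [ha, haS.2]
          have hlt : (R ∪ S \ N j).card < n := by
            rw [← hS]
            refine Finset.card_lt_card ((Finset.ssubset_iff_of_subset ?_).2 ⟨a, haS.1, hnot⟩)
            exact Finset.union_subset (hR.2.trans Finset.inter_subset_left) Finset.sdiff_subset
          have h1 := ih _ hlt _ rfl a hnot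
          rw [Finset.card_insert_of_notMem ha, Finset.insert_union, pow_succ', mul_assoc]
          exact (mul_le_mul_of_nonneg_left (ihR hR.2) (by linarith)).trans h1
      have h1 := hadd _ subset_rfl
      rw [Finset.union_comm, Finset.sdiff_union_inter] at h1
      have h2 : weight p (bad j ∩ avoid bad S) ≤ P * weight p (avoid bad (S \ N j)) := by
        refine (weight_mono hp ?_).trans (hind j _ Finset.sdiff_disjoint)
        exact Set.inter_subset_inter_right _ fun ω hω i hi => hω i (Finset.mem_sdiff.1 hi).1
      have h3 : (1 - x) ^ D ≤ (1 - x) ^ (S ∩ N j).card :=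
        pow_le_pow_of_le_one (by linarith) (by linarith)
          ((Finset.card_le_card Finset.inter_subset_right).trans (hN j))
      have h4 : P * weight p (avoid bad (S \ N j)) ≤ x * weight p (avoid bad S) := by
        calc P * weight p (avoid bad (S \ N j))
            ≤ (x * (1 - x) ^ (S ∩ N j).card) * weight p (avoid bad (S \ N j)) :=
              mul_le_mul_of_nonneg_right (hP.trans (mul_le_mul_of_nonneg_left h3 hx0))
                (weight_nonneg hp _)
          _ ≤ x * weight p (avoid bad S) := by
              rw [mul_assoc]; exact mul_le_mul_of_nonneg_left h1 hx0
      have h5 := weight_avoid_eq_add p bad S j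
      linarith
  induction S using Finset.induction_on with
  | empty => simp [avoid]
  | insert j S hj ih =>
    rw [Finset.card_insert_of_notMem hj, pow_succ', mul_assoc]
    exact (mul_le_mul_of_nonneg_left ih (by linarith)).trans (key _ S rfl j hj)

end LocalLemma

/-! ### Blocks of sites -/

section Blocks

variable {L : ℕ}

/-- The `j`-th block of `t` consecutive sites, `{j t, …, j t + t - 1}`. The last block may wrap
around the chain. -/
def block (L t j : ℕ) : Set (ZMod L) := {x | ∃ i : ℕ, i < t ∧ x = ((j * t + i : ℕ) : ZMod L)}

lemma exists_mem_block [NeZero L] {t : ℕ} (ht : 1 ≤ t) (x : ZMod L) :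
    ∃ j : Fin (L / t + 1), x ∈ block L t j := by
  refine ⟨⟨x.val / t, ?_⟩, x.val % t, Nat.mod_lt _ ht, ?_⟩
  · exact Nat.lt_succ_of_le (Nat.div_le_div_right (ZMod.val_lt x).le)
  · rw [mul_comm, Nat.div_add_mod, ZMod.natCast_zmod_val]

lemma nbhd_block_subset (t j : ℕ) : nbhd t (block L t j) ⊆
    ((Finset.Ico (-(t : ℤ)) ((2 * t : ℕ) : ℤ)).image
      fun k : ℤ => ((((j * t : ℕ) : ℤ) + k : ℤ) : ZMod L) : Finset (ZMod L)) := by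
  rintro _ ⟨_, ⟨i, hi, rfl⟩, k, hk, rfl⟩
  rw [abs_le] at hk
  rw [Finset.mem_coe, Finset.mem_image]
  refine ⟨i + k, ?_, by push_cast; ring⟩
  rw [Finset.mem_Ico]
  push_cast
  constructor <;> linarith [(Nat.cast_nonneg i : (0 : ℤ) ≤ i), (by exact_mod_cast hi : (i : ℤ) < t)]

open Classical in
/-- The blocks whose `2t`-neighbourhood meets that of the block `j`. -/
def blockNeighbours (L t : ℕ) (j : Fin (L / t + 1)) : Finset (Fin (L / t + 1)) :=
  Finset.univ.filter fun i => ¬ Disjoint (nbhd (2 * t) (block L t j)) (nbhd (2 * t) (block L t i))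

lemma mem_blockNeighbours {t : ℕ} {i j : Fin (L / t + 1)} : i ∈ blockNeighbours L t j ↔
    ¬ Disjoint (nbhd (2 * t) (block L t j)) (nbhd (2 * t) (block L t i)) := by
  simp [blockNeighbours]

/-- Two numbers in `[0, n]` whose difference, in units of `t`, lies within `5 t` of a multiple of
`L ≥ n t` are at most five steps apart on the cycle of length `n + 1`. -/
lemma exists_cyclic_step {i j n t L c : ℤ} (ht : 1 ≤ t) (hn : 11 ≤ n) (hi0 : 0 ≤ i) (hi1 : i ≤ n)
    (hj0 : 0 ≤ j) (hj1 : j ≤ n) (hL : n * t ≤ L) (hup : (i - j) * t < L * c + 5 * t)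
    (hdn : L * c - 5 * t < (i - j) * t) :
    ∃ m s : ℤ, -5 ≤ m ∧ m ≤ 5 ∧ j + m = i + s * (n + 1) := by
  have ht0 : 0 ≤ t := by linarith
  have h11 : 11 * t ≤ n * t := mul_le_mul_of_nonneg_right hn ht0
  have hle : (i - j) * t ≤ n * t := mul_le_mul_of_nonneg_right (by linarith) ht0
  have hge : -n * t ≤ (i - j) * t := mul_le_mul_of_nonneg_right (by linarith) ht0
  have hL0 : 0 ≤ L := by linarith
  have hc1 : c ≤ 1 := by
    by_contra h
    have := mul_le_mul_of_nonneg_left (show 2 ≤ c by omega) hL0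
    linarith
  have hc2 : -1 ≤ c := by
    by_contra h
    have := mul_le_mul_of_nonneg_left (show c ≤ -2 by omega) hL0
    linarith
  obtain rfl | rfl | rfl : c = -1 ∨ c = 0 ∨ c = 1 := by omega
  · have : i - j < -n + 5 := lt_of_mul_lt_mul_right (by linarith) ht0
    exact ⟨i - j + (n + 1), 1, by omega, by omega, by ring⟩
  · have h1 : i - j < 5 := lt_of_mul_lt_mul_right (by linarith) ht0
    have h2 : -5 < i - j := lt_of_mul_lt_mul_right (by linarith) ht0
    exact ⟨i - j, 0, by omega, by omega, by ring⟩
  · have : n - 5 < i - j := lt_of_mul_lt_mul_right (by linarith) ht0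
    exact ⟨i - j - (n + 1), -1, by omega, by omega, by ring⟩

lemma card_blockNeighbours_le {t : ℕ} (ht : 1 ≤ t) (j : Fin (L / t + 1)) :
    (blockNeighbours L t j).card ≤ 11 := by
  classical
  by_cases hn : L / t + 1 ≤ 11
  · exact (Finset.card_le_univ _).trans (by simpa using hn)
  -- Along the cycle of blocks, all neighbours lie within five steps of `j`.
  have hn0 : (0 : ℤ) < ((L / t + 1 : ℕ) : ℤ) := by positivity
  let F : ℤ → Fin (L / t + 1) := fun m =>
    ⟨(((j : ℕ) + m) % ((L / t + 1 : ℕ) : ℤ)).toNat, by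
      have h1 := Int.emod_nonneg ((j : ℕ) + m) hn0.ne'
      have h2 := Int.emod_lt_of_pos ((j : ℕ) + m) hn0
      omega⟩
  have hsub : blockNeighbours L t j ⊆ (Finset.Icc (-5 : ℤ) 5).image F := by
    intro i hi
    have hi' := mem_blockNeighbours.1 hi
    rw [Set.not_disjoint_iff] at hi'
    obtain ⟨_, ⟨_, ⟨a, ha, rfl⟩, k, hk, rfl⟩, _, ⟨b, hb, rfl⟩, k', hk', heq⟩ := hi'
    have hdvd : (L : ℤ) ∣ ((i : ℕ) * t + b + k') - ((j : ℕ) * t + a + k) := by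
      rw [← ZMod.intCast_eq_intCast_iff_dvd_sub]
      push_cast at heq ⊢
      exact heq
    obtain ⟨c, hc⟩ := hdvd
    rw [abs_le] at hk hk'
    push_cast at hk hk'
    have hlow : ((L / t : ℕ) : ℤ) * t ≤ L := by exact_mod_cast Nat.div_mul_le_self L t
    set n1 : ℤ := ((L / t : ℕ) : ℤ) with hn1
    have hn11 : 11 ≤ n1 := by omega
    have hi1 : ((i : ℕ) : ℤ) ≤ n1 := by have := i.2; omega
    have hj1 : ((j : ℕ) : ℤ) ≤ n1 := by have := j.2; omega
    have hi0 : (0 : ℤ) ≤ ((i : ℕ) : ℤ) := by positivity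
    have hj0 : (0 : ℤ) ≤ ((j : ℕ) : ℤ) := by positivity
    have ha' : (a : ℤ) < t := by exact_mod_cast ha
    have hb' : (b : ℤ) < t := by exact_mod_cast hb
    have ha0 : (0 : ℤ) ≤ a := by positivity
    have hb0 : (0 : ℤ) ≤ b := by positivity
    have ht' : (1 : ℤ) ≤ t := by exact_mod_cast ht
    obtain ⟨m, s, hm1, hm2, hs⟩ := exists_cyclic_step ht' hn11 hi0 hi1 hj0 hj1 hlow
      (c := c) (by linarith) (by linarith)
    rw [Finset.mem_image]
    refine ⟨m, Finset.mem_Icc.2 ⟨hm1, hm2⟩, Fin.ext ?_⟩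
    change (((j : ℕ) + m) % ((L / t + 1 : ℕ) : ℤ)).toNat = (i : ℕ)
    have hcast : ((L / t + 1 : ℕ) : ℤ) = n1 + 1 := by push_cast; rfl
    rw [hcast, hs, Int.add_mul_emod_self_right, Int.emod_eq_of_lt hi0 (by omega), Int.toNat_natCast]
  refine (Finset.card_le_card hsub).trans (Finset.card_image_le.trans ?_)
  simp

end Blocks

/-! ### Measuring the twisted circuit state -/

section Measurement

variable {L d : ℕ} [NeZero L]

lemma localOn_unitaryProd_conj (w : ZMod L → Matrix.unitaryGroup (Fin d) ℂ) {S : Set (ZMod L)}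
    {A : Op L d} (hA : LocalOn S A) :
    LocalOn S ((unitaryProd w)ᴴ * A * unitaryProd w) := by
  refine localOn_conj_of_commute (unitaryProd_isometry w) fun x hx B => ?_
  have hloc : LocalOn {x} (unitaryProd w * siteOp B x * (unitaryProd w)ᴴ) := by
    rw [siteOp_eq_prodOp, unitaryProd, prodOp_conjTranspose, prodOp_mul, prodOp_mul]
    refine localOn_prodOp fun y hy => ?_
    rw [Function.update_of_ne hy, Matrix.mul_one, ← Matrix.star_eq_conjTranspose]
    exact Matrix.mem_unitaryGroup_iff.1 (w y).2
  exact hA.commute hloc (Set.disjoint_singleton_right.2 hx)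

/-- If the twist makes `ψ` orthogonal to itself, a state `δ`-close to `ψ` has a small overlap with
its own twist. -/
lemma norm_inner_apply_le {U : Op L d} (hU : Uᴴ * U = 1) {φ ψ' : Hilb L d} {δ : ℝ}
    (hφ : ‖φ‖ = 1) (hψ : ‖ψ'‖ = 1) (h : ‖φ - ψ'‖ ≤ δ) (h0 : inner ℂ ψ' (apply U ψ') = 0) :
    ‖inner ℂ φ (apply U φ)‖ ≤ 2 * δ := by
  have heq : inner ℂ φ (apply U φ) =
      inner ℂ (φ - ψ') (apply U φ) + inner ℂ ψ' (apply U (φ - ψ')) := by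
    rw [inner_sub_left, apply_vec_sub, inner_sub_right, h0]
    ring
  rw [heq, two_mul]
  refine (norm_add_le _ _).trans (add_le_add ?_ ?_)
  · refine (norm_inner_le_norm _ _).trans ?_
    rwa [norm_apply_of_isometry hU, hφ, mul_one]
  · refine (norm_inner_le_norm _ _).trans ?_
    rwa [norm_apply_of_isometry hU, hψ, one_mul]

variable [NeZero d]

open Classical in
/-- The projector onto the configurations that vanish on `X`. -/
def zeroProj (X : Set (ZMod L)) : Op L d :=
  Matrix.diagonal fun f => if ∀ x ∈ X, f x = 0 then 1 else 0

lemma localOn_zeroProj (X : Set (ZMod L)) : LocalOn X (zeroProj X : Op L d) := by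
  classical
  intro x hx B
  ext f g
  rw [zeroProj, Matrix.diagonal_mul, Matrix.mul_diagonal, mul_comm]
  by_cases h : ∀ y, y ≠ x → f y = g y
  · congr 2
    refine propext (forall₂_congr fun y hy => ?_)
    rw [h y fun hyx => hx (hyx ▸ hy)]
  · simp [siteOp, h]

/-- The configurations that are nonzero somewhere on `X`. -/
def excited (L d : ℕ) [NeZero d] (X : Set (ZMod L)) : Set (Config L d) := {f | ∃ x ∈ X, f x ≠ 0}

/-- The probability of the outcome `f` when the state `W|0^L⟩` is measured in the configuration
basis. -/
def outcome (W : Op L d) (f : Config L d) : ℝ := ‖W f (fun _ => 0)‖ ^ 2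

lemma weight_outcome (W : Op L d) (E : Set (Config L d)) [DecidablePred (· ∈ E)] :
    (weight (outcome W) E : ℂ) =
      (Wᴴ * (Matrix.diagonal (fun f => if f ∈ E then 1 else 0) : Op L d) * W) (fun _ => 0) (fun _ => 0) := by
  rw [Matrix.mul_apply, weight]
  push_cast
  refine Finset.sum_congr rfl fun f _ => ?_
  rw [Matrix.mul_diagonal, Matrix.conjTranspose_apply]
  by_cases h : f ∈ E
  · rw [Set.indicator_of_mem h, if_pos h, mul_one, mul_comm, outcome, RCLike.star_def,
      Complex.mul_conj, Complex.normSq_eq_norm_sq]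
  · simp [h]

lemma weight_outcome_univ {W : Op L d} (hW : Wᴴ * W = 1) : weight (outcome W) Set.univ = 1 := by
  classical
  have h := weight_outcome W Set.univ
  simp only [Set.mem_univ, if_true, Matrix.diagonal_one, Matrix.mul_one, hW,
    Matrix.one_apply_eq] at h
  exact_mod_cast h

lemma excited_diagonal (X : Set (ZMod L)) [DecidablePred (· ∈ excited L d X)] :
    (Matrix.diagonal (fun f => if f ∈ excited L d X then 1 else 0) : Op L d) = 1 - zeroProj X := by
  classical
  rw [zeroProj, ← Matrix.diagonal_one, Matrix.diagonal_sub]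
  congr 1
  ext1 f
  by_cases h : ∀ x ∈ X, f x = 0
  · have h' : f ∉ excited L d X := fun ⟨x, hx, hne⟩ => hne (h x hx)
    simp [h', if_pos h]
  · have h' : f ∈ excited L d X := by push Not at h; exact h
    simp [h', if_neg h]

lemma weight_outcome_excited (W : Op L d) (X : Set (ZMod L)) :
    weight (outcome W) (excited L d X) =
      ‖apply (1 - zeroProj X) (apply W (zeroState L d))‖ ^ 2 := by
  classical
  rw [← excited_diagonal, EuclideanSpace.norm_sq_eq, weight]
  refine Finset.sum_congr rfl fun f _ => ?_
  rw [← apply_mul, apply_zeroState, Matrix.diagonal_mul]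
  by_cases h : f ∈ excited L d X <;> simp [h, outcome]

lemma norm_apply_one_sub_zeroProj_le (X : Set (ZMod L)) (ξ : Hilb L d) :
    ‖apply (1 - zeroProj X) ξ‖ ≤ ‖ξ‖ := by
  classical
  rw [← excited_diagonal]
  refine (sq_le_sq₀ (norm_nonneg _) (norm_nonneg _)).1 ?_
  rw [EuclideanSpace.norm_sq_eq, EuclideanSpace.norm_sq_eq]
  refine Finset.sum_le_sum fun f _ => ?_
  have : apply (Matrix.diagonal (fun f => if f ∈ excited L d X then 1 else 0) : Op L d) ξ f =
      (if f ∈ excited L d X then 1 else 0) * ξ f := by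
    simp [apply, Matrix.toLpLin_apply, Matrix.mulVec_diagonal]
  rw [this]
  by_cases h : f ∈ excited L d X
  · simp [h]
  · simp [h]

/-- Excitations of the twisted circuit state on regions with disjoint light cones are
independent. -/
lemma weight_excited_inter {t : ℕ} {V : Op L d} (hV : IsCircuit t V)
    (w : ZMod L → Matrix.unitaryGroup (Fin d) ℂ) {X Y : Set (ZMod L)}
    (h : Disjoint (nbhd (2 * t) X) (nbhd (2 * t) Y)) :
    weight (outcome (Vᴴ * unitaryProd w * V)) (excited L d X ∩ (excited L d Y)ᶜ) =
      weight (outcome (Vᴴ * unitaryProd w * V)) (excited L d X) *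
        weight (outcome (Vᴴ * unitaryProd w * V)) (excited L d Y)ᶜ := by
  classical
  set U := unitaryProd w
  set W := Vᴴ * U * V with hW
  have hVV : V * Vᴴ = 1 := mul_eq_one_comm.1 hV.isometry
  have hUU : U * Uᴴ = 1 := mul_eq_one_comm.1 (unitaryProd_isometry w)
  have hWW : W * Wᴴ = 1 := by
    calc W * Wᴴ = Vᴴ * (U * (V * Vᴴ) * Uᴴ) * V := by
          simp only [hW, Matrix.conjTranspose_mul, Matrix.conjTranspose_conjTranspose,
            Matrix.mul_assoc]
      _ = 1 := by rw [hVV, Matrix.mul_one, hUU, Matrix.mul_one, hV.isometry]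
  have hloc : ∀ {X : Set (ZMod L)} {A : Op L d}, LocalOn X A →
      LocalOn (nbhd (2 * t) X) (Wᴴ * A * W) := by
    intro X A hA
    have h1 := hV.localOn_conj' (localOn_unitaryProd_conj w (hV.localOn_conj hA))
    have h2 := h1.mono (nbhd_nbhd_subset t t X)
    rw [← two_mul] at h2
    have : Wᴴ * A * W = Vᴴ * (Uᴴ * (V * A * Vᴴ) * U) * V := by
      simp only [hW, Matrix.conjTranspose_mul, Matrix.conjTranspose_conjTranspose,
        Matrix.mul_assoc]
    rwa [this]
  have hYc : (Matrix.diagonal (fun f => if f ∈ (excited L d Y)ᶜ then 1 else 0) : Op L d) =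
      zeroProj Y := by
    rw [zeroProj]
    congr 1
    ext1 f
    simp [excited]
  have hprod := (hloc (localOn_zeroProj X).one_sub).mul_apply_const (hloc (localOn_zeroProj Y)) h
    (fun _ => (0 : Fin d))
  have hmul : Wᴴ * (1 - zeroProj X) * W * (Wᴴ * zeroProj Y * W) =
      Wᴴ * ((1 - zeroProj X) * zeroProj Y) * W := by
    calc _ = Wᴴ * (1 - zeroProj X) * (W * Wᴴ) * zeroProj Y * W := by
          simp only [Matrix.mul_assoc]
      _ = _ := by rw [hWW, Matrix.mul_one]; simp only [Matrix.mul_assoc]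
  have hinter : (Matrix.diagonal (fun f => if f ∈ excited L d X ∩ (excited L d Y)ᶜ then 1 else 0) :
      Op L d) = (1 - zeroProj X) * zeroProj Y := by
    rw [← hYc, ← excited_diagonal, Matrix.diagonal_mul_diagonal]
    congr 1
    ext1 f
    by_cases h1 : f ∈ excited L d X <;> by_cases h2 : f ∈ excited L d Y <;> simp [h1, h2]
  rw [hmul, ← hinter, ← excited_diagonal, ← hYc, ← weight_outcome, ← weight_outcome,
    ← weight_outcome] at hprod
  exact_mod_cast hprod

end Measurement

/-! ### Numerical estimates -/

/-- The choice `x = 2y² + δ/2` meets the hypothesis of the local lemma with `11` neighbours, and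
leaves room for `x ≤ e (δ + y²)` in `lt_of_pow_le`. -/
lemma local_lemma_condition {y δ : ℝ} (hy : 0 ≤ y) (hδ : 0 ≤ δ) (h : y + δ < 1 / 19) :
    (10 / 9 * y + 2 * δ) ^ 2 ≤ (2 * y ^ 2 + δ / 2) * (1 - (2 * y ^ 2 + δ / 2)) ^ 11 := by
  set x := 2 * y ^ 2 + δ / 2 with hx
  have hx0 : 0 ≤ x := by positivity
  have hx1 : x ≤ 1 / 38 := by nlinarith
  have hb : 27 / 38 ≤ (1 - x) ^ 11 := by
    have := one_add_mul_le_pow (a := -x) (by linarith) 11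
    rw [← sub_eq_add_neg] at this
    norm_num at this
    linarith
  refine le_trans ?_ (mul_le_mul_of_nonneg_left hb hx0)
  rw [hx]
  nlinarith [mul_nonneg hy hδ, mul_nonneg hδ (sub_nonneg.2 h.le), sq_nonneg y]

/-- The bounds on the overlap from the local lemma and from orthogonality, combined. The exponent
`⌊L / t⌋ + 1` exceeds `L / t`, but the extra factor `1 - x` is absorbed by `4δ² < (1 - x) δ`. -/
lemma lt_of_pow_le {y δ w : ℝ} {L t : ℕ} (hy : 0 ≤ y) (hδ : 0 ≤ δ)
    (h : y + δ < 1 / 19) (hlow : (1 - (2 * y ^ 2 + δ / 2)) ^ (L / t + 1) ≤ w)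
    (hup : w ≤ (2 * δ) ^ 2) :
    (1 - Real.exp 1 * δ - Real.exp 1 * y ^ 2) ^ ((L : ℝ) / (t : ℝ)) < δ := by
  have he1 := Real.exp_one_gt_d9
  have he2 := Real.exp_one_lt_d9
  set x := 2 * y ^ 2 + δ / 2 with hx
  set b := 1 - Real.exp 1 * δ - Real.exp 1 * y ^ 2 with hb
  have hx1 : x ≤ 1 / 38 := by nlinarith
  have hy2 : y ^ 2 ≤ 1 / 19 - δ := by nlinarith
  have hb0 : 0 < b := by nlinarith [sq_nonneg y]
  have hb1 : b ≤ 1 := by nlinarith [sq_nonneg y]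
  have hbx : b ≤ 1 - x := by nlinarith [sq_nonneg y]
  have hδ0 : 0 < δ := by
    rcases hδ.eq_or_lt with h0 | h0
    · have : 0 < (1 - x) ^ (L / t + 1) := by
        apply pow_pos; linarith
      rw [← h0] at hup
      norm_num at hup
      linarith
    · exact h0
  have h1 : b ^ ((L : ℝ) / (t : ℝ)) ≤ (1 - x) ^ (L / t) := by
    calc b ^ ((L : ℝ) / (t : ℝ)) ≤ b ^ (((L / t : ℕ) : ℝ)) :=
          Real.rpow_le_rpow_of_exponent_ge hb0 hb1 Nat.cast_div_le
      _ = b ^ (L / t) := Real.rpow_natCast _ _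
      _ ≤ (1 - x) ^ (L / t) := pow_le_pow_left₀ hb0.le hbx _
  refine h1.trans_lt ?_
  rw [pow_succ] at hlow
  have hpos : 0 ≤ (1 - x) ^ (L / t) := pow_nonneg (by linarith) _
  nlinarith

/-- The negation of the second alternative, as a bound on the cost of the local twist. -/
lemma twist_cost_lt {L t : ℕ} {Q δ : ℝ} (hL : 0 < L) (ht : 1 ≤ t) (hQ : 0 ≤ Q)
    (h : (t : ℝ) < (L : ℝ) ^ (1 / 2 : ℝ) *
      √(2 / (9 * Real.pi * Q) * (1 / (7 * Real.exp 1) - δ))) :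
    9 * Real.pi * (t : ℝ) ^ 2 * Q / (2 * (L : ℝ)) + δ < 1 / 19 := by
  have hL' : (0 : ℝ) < L := Nat.cast_pos.2 hL
  have ht' : (1 : ℝ) ≤ t := by exact_mod_cast ht
  rw [← Real.sqrt_eq_rpow, ← Real.sqrt_mul hL'.le] at h
  have h2 := (Real.lt_sqrt (by linarith)).1 h
  have hQ0 : 0 < Q := by
    rcases hQ.eq_or_lt with h0 | h0
    · -- For `Q = 0` the division by zero turns the square root into `0`, against `1 ≤ t`.
      rw [← h0] at h2
      norm_num at h2
      nlinarith
    · exact h0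
  have hπ := Real.pi_pos
  have h3 : 9 * Real.pi * (t : ℝ) ^ 2 * Q / (2 * (L : ℝ)) < 1 / (7 * Real.exp 1) - δ := by
    rw [div_lt_iff₀ (by positivity)]
    have h4 := mul_lt_mul_of_pos_left h2 (by positivity : 0 < 9 * Real.pi * Q)
    have h5 : 9 * Real.pi * Q * (L * (2 / (9 * Real.pi * Q) * (1 / (7 * Real.exp 1) - δ))) =
        (1 / (7 * Real.exp 1) - δ) * (2 * L) := by
      field_simp
    rw [h5] at h4
    linarith
  have he1 := Real.exp_one_gt_d9
  have h6 : 1 / (7 * Real.exp 1) ≤ 1 / 19 := one_div_le_one_div_of_le (by norm_num) (by linarith)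
  linarith

end SpinChain

end

theorem mainTheorem5 (L d : ℕ) [NeZero L] [NeZero d]
    (q : Matrix (Fin d) (Fin d) ℂ) (hq : q.IsHermitian)
    (hq_int : ∀ μ ∈ spectrum ℂ q, ∃ k : ℤ, μ = (k : ℂ))
    (ψ : SpinChain.Hilb L d) (hψ : ‖ψ‖ = 1)
    (hT : ∃ c : ℂ, SpinChain.apply (SpinChain.translation L d) ψ = c • ψ)
    (α : ℝ) (hα : Complex.exp (Complex.I * α) ≠ 1)
    (hQ : SpinChain.apply
        (NormedSpace.exp ((2 * (Real.pi : ℂ) * Complex.I / (L : ℂ)) • SpinChain.totalCharge L q)) ψ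
      = Complex.exp (Complex.I * α) • ψ)
    (δ : ℝ) (t : ℕ) (ht : 1 ≤ t) (hC : SpinChain.approxComplexity δ ψ = (t : ℕ∞)) :
    δ > (1 - Real.exp 1 * δ
          - Real.exp 1 * (9 * Real.pi * (t : ℝ) ^ 2 * SpinChain.opNorm q / (2 * (L : ℝ))) ^ 2)
        ^ ((L : ℝ) / (t : ℝ)) ∨
    (t : ℝ) ≥ (L : ℝ) ^ (1 / 2 : ℝ) *
      √(2 / (9 * Real.pi * SpinChain.opNorm q) * (1 / (7 * Real.exp 1) - δ)) := by
  open SpinChain in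
  open scoped Matrix.Norms.L2Operator in
  rw [or_iff_not_imp_right]
  intro hlt
  rw [ge_iff_le, not_le] at hlt
  have hL : 0 < L := NeZero.pos L
  have hQ0 : 0 ≤ opNorm q := norm_nonneg _
  have hcost := twist_cost_lt hL ht hQ0 hlt
  set y := 9 * Real.pi * (t : ℝ) ^ 2 * opNorm q / (2 * (L : ℝ)) with hy
  have hy0 : 0 ≤ y := by have := Real.pi_pos; positivity
  obtain ⟨V, hV, hVδ⟩ := exists_circuit_of_approxComplexity_eq hC
  set φ := apply V (zeroState L d) with hφ_def
  have hφ : ‖φ‖ = 1 := by rw [hφ_def, norm_apply_of_isometry hV.isometry, norm_zeroState]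
  have hδ : 0 ≤ δ := (traceNorm_nonneg _).trans hVδ
  obtain ⟨c, hc, hcδ⟩ := exists_phase_norm_sub_le hψ hφ hVδ
  obtain ⟨v, hvexp, hvL, hv1⟩ := exists_twist (L := L) hq hq_int
  have hE : apply (unitaryProd fun _ : ZMod L => v) ψ = Complex.exp (Complex.I * α) • ψ := by
    rw [← hQ, exp_totalCharge, ← hvexp]
    rfl
  have hμ : ‖Complex.exp (Complex.I * α)‖ = 1 := by
    rw [mul_comm, Complex.norm_exp_ofReal_mul_I]
  set U := twist L v with hU
  have hUi : Uᴴ * U = 1 := unitaryProd_isometry _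
  obtain ⟨c', hc'⟩ := hT
  have horth : inner ℂ (c • ψ) (apply U (c • ψ)) = 0 := by
    rw [apply_smul, inner_smul_left, inner_smul_right, inner_twist_eq_zero hvL hψ hc' hE hα]
    simp
  have hover : ‖inner ℂ φ (apply U φ)‖ ≤ 2 * δ :=
    norm_inner_apply_le hUi hφ (by rw [norm_smul, hc, hψ, one_mul]) hcδ horth
  set W := Vᴴ * U * V with hW
  have hWi : Wᴴ * W = 1 := by
    refine isometry_mul (isometry_mul ?_ hUi) hV.isometry
    rw [Matrix.conjTranspose_conjTranspose]
    exact mul_eq_one_comm.1 hV.isometry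
  have hp : ∀ f, 0 ≤ outcome W f := fun f => sq_nonneg _
  -- The probability that a given block is found excited.
  have hbad : ∀ j : ℕ, weight (outcome W) (excited L d (block L t j)) ≤
      (10 / 9 * y + 2 * δ) ^ 2 := by
    intro j
    set A : Op L d := V * (1 - zeroProj (block L t j)) * Vᴴ with hA
    have hVV : Vᴴᴴ * Vᴴ = 1 := by
      rw [Matrix.conjTranspose_conjTranspose]; exact mul_eq_one_comm.1 hV.isometry
    have hAn : ∀ ξ, ‖apply A ξ‖ = ‖apply (1 - zeroProj (block L t j)) (apply Vᴴ ξ)‖ := by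
      intro ξ
      rw [hA, apply_mul, apply_mul, norm_apply_of_isometry hV.isometry]
    have hA1 : ∀ ξ, ‖apply A ξ‖ ≤ ‖ξ‖ := fun ξ => by
      rw [hAn]
      exact (norm_apply_one_sub_zeroProj_le _ _).trans (norm_apply_of_isometry hVV ξ).le
    have hA0 : apply A φ = 0 := by
      rw [← norm_eq_zero, hAn, hφ_def, ← apply_mul Vᴴ, hV.isometry, apply_one, norm_eq_zero]
      ext f
      rw [apply_zeroState]
      by_cases hf : f = fun _ => 0
      · subst hf; simp [zeroProj]
      · simp [zeroProj, hf]
    have hloc := (hV.localOn_conj (localOn_zeroProj (block L t j)).one_sub).mono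
      (nbhd_block_subset t j)
    have hmain := norm_local_apply_twist_le hφ hcδ hμ hE hloc hA1 hA0 (j * t)
    have hsum := sum_norm_twist_le hvL (j * t) t
    have hfin : ‖apply A (apply U φ)‖ ≤ 10 / 9 * y + 2 * δ := by
      refine hmain.trans (add_le_add_left (hsum.trans ?_) _)
      -- `5/2 t² * (2π ‖q‖ / L) = 10/9 y`.
      refine (mul_le_mul_of_nonneg_left hv1 (by positivity)).trans (le_of_eq ?_)
      rw [hy]
      field_simp
      ring
    rw [weight_outcome_excited, hW, apply_mul, apply_mul, ← hφ_def, ← hAn]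
    exact pow_le_pow_left₀ (norm_nonneg _) hfin 2
  have havoid : ∀ S : Finset (Fin (L / t + 1)),
      avoid (fun j : Fin (L / t + 1) => excited L d (block L t j)) S =
        (excited L d (⋃ j ∈ S, block L t j))ᶜ := by
    intro S
    ext f
    simp only [avoid, excited, Set.mem_ofPred_eq, Set.mem_compl_iff, Set.mem_iUnion]
    push Not
    exact ⟨fun h x ⟨j, hj, hx⟩ => h j hj x hx, fun h j hj x hx => h x ⟨j, hj, hx⟩⟩
  have hLLL := lovasz_local_lemma hp (fun j : Fin (L / t + 1) => excited L d (block L t j))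
    (blockNeighbours L t) (card_blockNeighbours_le ht) (by positivity)
    (show 2 * y ^ 2 + δ / 2 ≤ 1 by nlinarith) (local_lemma_condition hy0 hδ hcost) (by
      intro j S hS
      have hdisj : Disjoint (nbhd (2 * t) (block L t j))
          (nbhd (2 * t) (⋃ i ∈ S, block L t i)) := by
        rw [Set.disjoint_left]
        rintro x hx ⟨s, hs, k, hk, rfl⟩
        obtain ⟨i, hi, hsi⟩ := Set.mem_iUnion₂.1 hs
        refine Finset.disjoint_left.1 hS hi (mem_blockNeighbours.2 ?_)
        exact Set.not_disjoint_iff.2 ⟨_, hx, s, hsi, k, hk, rfl⟩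
      rw [havoid]
      refine (weight_excited_inter hV (fun x => v ^ (x.val : ℤ)) hdisj).le.trans ?_
      exact mul_le_mul_of_nonneg_right (hbad j) (weight_nonneg hp _)) Finset.univ
  rw [weight_outcome_univ hWi, mul_one, Finset.card_univ, Fintype.card_fin] at hLLL
  refine lt_of_pow_le hy0 hδ hcost hLLL ?_
  -- Only the zero configuration avoids all excitations.
  have hzero : avoid (fun j : Fin (L / t + 1) => excited L d (block L t j)) Finset.univ =
      {fun _ => 0} := by
    ext f
    simp only [avoid, excited, Set.mem_ofPred_eq, Set.mem_singleton_iff, Finset.mem_univ,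
      true_imp_iff]
    push Not
    refine ⟨fun h => funext fun x => ?_, fun h j x _ => by rw [h]⟩
    obtain ⟨j, hj⟩ := exists_mem_block ht x
    exact h j x hj
  have hW0 : W (fun _ => 0) (fun _ => 0) = inner ℂ φ (apply U φ) := by
    have h1 : inner ℂ φ (apply U φ) = inner ℂ (zeroState L d) (apply W (zeroState L d)) := by
      rw [hW, apply_mul, apply_mul, inner_apply_right Vᴴ, Matrix.conjTranspose_conjTranspose]
    rw [h1, zeroState, EuclideanSpace.inner_single_left, ← zeroState, apply_zeroState]
    simp
  have hwt : weight (outcome W) {fun _ => 0} = ‖inner ℂ φ (apply U φ)‖ ^ 2 := by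
    rw [weight, Finset.sum_eq_single (fun _ => 0)]
    · rw [Set.indicator_of_mem (Set.mem_singleton _), outcome, hW0]
    · intro f _ hf
      exact Set.indicator_of_notMem (by simpa using hf) _
    · simp
  rw [hzero, hwt]
  exact pow_le_pow_left₀ (norm_nonneg _) hover 2
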